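/- Let $\hat{\mathfrak f}_5$ be the degree completion of the free complex Lie algebra on generators $A$, $b[\zeta]$ ($\zeta\in\mu_4(\mathbb C)=\{1,i,-1,-i\}$), all of degree $1$, viewed inside the algebra of noncommutative formal power series in these generators, and put $C:=-A-\sum_{\zeta\in\mu_4(\mathbb C)}b[\zeta]$. For $a\in\mathbb C\setminus\mathbb R_-$ and $x\in\hat{\mathfrak f}_5$ let $a^x:=\exp(\ln(a)\,x)$, where the imaginary part of $\ln(a)$ lies in $]-\pi,\pi[$. Consider on $]0,1[$ the differential equation $$\frac{dH}{dz}=\Big(\frac{A}{z}+\sum_{\zeta\in\mu_4(\mathbb C)}\frac{b[\zeta]}{z-\zeta}\Big)H ,$$ for $H$ with values in the invertible noncommutative formal power series in the generators (derivatives and limits being taken coefficient by coefficient). Let $H_0,H_1$ be its solutions with $H_0(z)\simeq z^A$ as $z\to0^+$ and $H_1(z)\simeq(1-z)^{b[1]}$ as $z\to1^-$, i.e. $H_0(z)z^{-A}\to1$ and $H_1(z)(1-z)^{-b[1]}\to1$. Let $s$ be the automorphism of order $3$ given by $$A\mapsto b[1],\quad b[1]\mapsto b[i],\quad b[i]\mapsto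 A,\quad b[-1]\mapsto b[-i],\quad b[-i]\mapsto C,\quad C\mapsto b[-1]$$ (it is induced by the permutation $z\mapsto\frac{1+iz}{1-iz}$ of $\{0,\infty\}\cup\mu_4(\mathbb C)$, the generators $A$, $b[\zeta]$, $C$ corresponding to the points $0$, $\zeta$, $\infty$). Then the renormalized holonomy $\Psi_4:=H_1^{-1}H_0$ is well defined (it exists, is unique, and does not depend on $z\in{]0,1[}$), it belongs to the group $\exp(\hat{\mathfrak f}_5)$, and it satisfies the hexagon relation $$(2/i)^A\, s^2(\Psi_4)\,(2/i)^{b[i]}\, s(\Psi_4)\,(2/i)^{b[1]}\,\Psi_4=1 .$$ -/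

import Mathlib

open Filter Topology

noncomputable section

/-- The algebra `ℂ⟨⟨α⟩⟩` of noncommutative formal power series in the letters `α`: the degree
completion of the free associative algebra on `α`, i.e. of the enveloping algebra of the free Lie
algebra on `α`. A series is given by its coefficients, indexed by the words in the letters. -/
def NCSeries (α : Type) : Type := List α → ℂ

namespace NCSeries

variable {α : Type}

/-- The coefficient of the word `w`. -/
def coeff (f : NCSeries α) (w : List α) : ℂ := f w

@[ext] theorem ext {f g : NCSeries α} (h : ∀ w, coeff f w = coeff g w) : f = g := funext h

instance : AddCommGroup (NCSeries α) := inferInstanceAs (AddCommGroup (List α → ℂ))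

instance : Module ℂ (NCSeries α) := inferInstanceAs (Module ℂ (List α → ℂ))

@[simp] theorem coeff_add (f g : NCSeries α) (w : List α) :
    coeff (f + g) w = coeff f w + coeff g w := rfl

@[simp] theorem coeff_zero (w : List α) : coeff (0 : NCSeries α) w = 0 := rfl

@[simp] theorem coeff_smul (c : ℂ) (f : NCSeries α) (w : List α) :
    coeff (c • f) w = c * coeff f w := rfl

instance : One (NCSeries α) := ⟨fun w => if w.length = 0 then 1 else 0⟩

theorem coeff_one (w : List α) :
    coeff (1 : NCSeries α) w = if w.length = 0 then 1 else 0 := rfl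

/-- The concatenation product: the coefficient of `w` in `f * g` is the sum over all
factorizations `w = u v` of the product of the coefficient of `u` in `f` and of `v` in `g`. -/
instance : Mul (NCSeries α) :=
  ⟨fun f g w => ∑ k ∈ Finset.range (w.length + 1), coeff f (w.take k) * coeff g (w.drop k)⟩

theorem coeff_mul (f g : NCSeries α) (w : List α) :
    coeff (f * g) w =
      ∑ k ∈ Finset.range (w.length + 1), coeff f (w.take k) * coeff g (w.drop k) := rfl

/-- Removal of a first letter `a`, used to prove associativity. -/
def tail (a : α) (f : NCSeries α) : NCSeries α := fun w => coeff f (a :: w)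

theorem coeff_tail (a : α) (f : NCSeries α) (w : List α) :
    coeff (tail a f) w = coeff f (a :: w) := rfl

theorem coeff_mul_nil (f g : NCSeries α) :
    coeff (f * g) [] = coeff f [] * coeff g [] := by
  simp [coeff_mul]

theorem coeff_mul_cons (f g : NCSeries α) (a : α) (w : List α) :
    coeff (f * g) (a :: w) = coeff f [] * coeff g (a :: w) + coeff (tail a f * g) w := by
  rw [coeff_mul, List.length_cons, Finset.sum_range_succ', coeff_mul]
  simp [coeff_tail, add_comm]

theorem tail_mul (f g : NCSeries α) (a : α) :
    tail a (f * g) = coeff f [] • tail a g + tail a f * g := by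
  ext w
  simp [coeff_tail, coeff_mul_cons]

protected theorem add_mul' (f g h : NCSeries α) : (f + g) * h = f * h + g * h := by
  ext w
  simp [coeff_mul, add_mul, Finset.sum_add_distrib]

protected theorem mul_add' (f g h : NCSeries α) : f * (g + h) = f * g + f * h := by
  ext w
  simp [coeff_mul, mul_add, Finset.sum_add_distrib]

protected theorem smul_mul' (c : ℂ) (f g : NCSeries α) : (c • f) * g = c • (f * g) := by
  ext w
  simp [coeff_mul, Finset.mul_sum, mul_assoc]

protected theorem mul_smul' (c : ℂ) (f g : NCSeries α) : f * (c • g) = c • (f * g) := by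
  ext w
  simp [coeff_mul, Finset.mul_sum, mul_left_comm]

protected theorem zero_mul' (f : NCSeries α) : 0 * f = 0 := by
  ext w
  simp [coeff_mul]

protected theorem mul_zero' (f : NCSeries α) : f * 0 = 0 := by
  ext w
  simp [coeff_mul]

theorem tail_one (a : α) : tail a (1 : NCSeries α) = 0 := by
  ext w
  simp [coeff_tail, coeff_one]

protected theorem one_mul' (f : NCSeries α) : 1 * f = f := by
  ext w
  cases w with
  | nil => simp [coeff_mul_nil, coeff_one]
  | cons a w => simp [coeff_mul_cons, tail_one, NCSeries.zero_mul', coeff_one]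

protected theorem mul_one' (f : NCSeries α) : f * 1 = f := by
  ext w
  induction w generalizing f with
  | nil => simp [coeff_mul_nil, coeff_one]
  | cons a w ih => simp [coeff_mul_cons, ih, coeff_tail, coeff_one]

protected theorem mul_assoc' (f g h : NCSeries α) : f * g * h = f * (g * h) := by
  ext w
  induction w generalizing f with
  | nil => simp [coeff_mul_nil, mul_assoc]
  | cons a w ih =>
    simp only [coeff_mul_cons, coeff_mul_nil, tail_mul, NCSeries.add_mul', coeff_add,
      NCSeries.smul_mul', coeff_smul, ih]
    ring

instance : Ring (NCSeries α) :=
  { (inferInstance : AddCommGroup (NCSeries α)) with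
    mul := (· * ·)
    one := 1
    left_distrib := NCSeries.mul_add'
    right_distrib := NCSeries.add_mul'
    zero_mul := NCSeries.zero_mul'
    mul_zero := NCSeries.mul_zero'
    mul_assoc := NCSeries.mul_assoc'
    one_mul := NCSeries.one_mul'
    mul_one := NCSeries.mul_one' }

instance : Algebra ℂ (NCSeries α) := Algebra.ofModule NCSeries.smul_mul' NCSeries.mul_smul'

/-- The bracket is the commutator. -/
instance : LieRing (NCSeries α) := LieRing.ofAssociativeRing

open Classical in
/-- The letter `a`, as a series. -/
def X (a : α) : NCSeries α := fun w => if w = [a] then 1 else 0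

/-- The homogeneous component of degree `n`. -/
def homogeneousPart (n : ℕ) (f : NCSeries α) : NCSeries α :=
  fun w => if w.length = n then coeff f w else 0

/-- The exponential `∑ x ^ k / k!` of a series `x` without constant term: the terms with
`k > w.length` do not contribute to the coefficient of `w`. -/
def exp (x : NCSeries α) : NCSeries α :=
  fun w => ∑ k ∈ Finset.range (w.length + 1), ((k.factorial : ℂ)⁻¹) * coeff (x ^ k) w

/-- `a ^ x = exp (ln(a) x)`, for `a ∈ ℂ ∖ ℝ₋` and `x` without constant term, with the principal
branch of the logarithm. -/
def cpow (a : ℂ) (x : NCSeries α) : NCSeries α := exp (Complex.log a • x)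

/-- The continuous algebra endomorphism `f ↦ ∑_v f_v φ(v₁) ⋯ φ(vₙ)` of `ℂ⟨⟨α⟩⟩` that sends each
letter `a` to `φ a`, for `φ a` without constant terms: the words `v` longer than `w` do not
contribute to the coefficient of `w`. -/
def subst [Fintype α] (φ : α → NCSeries α) (f : NCSeries α) : NCSeries α :=
  fun w => ∑ n ∈ Finset.range (w.length + 1), ∑ v : Fin n → α,
    coeff f (List.ofFn v) * coeff (List.ofFn fun j => φ (v j)).prod w

/-- The degree completion of the free Lie algebra on `α`, inside `ℂ⟨⟨α⟩⟩`: the series all of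
whose homogeneous components are (images of) elements of the free Lie algebra, the bracket of
`ℂ⟨⟨α⟩⟩` being the commutator. -/
def freeLieCompletion (α : Type) : Set (NCSeries α) :=
  {x | ∀ n, homogeneousPart n x ∈ (FreeLieAlgebra.lift ℂ (X : α → NCSeries α)).range}

/-- The group `exp(𝔣̂)`, for `𝔣̂` the completed free Lie algebra on `α`. -/
def expFreeLie (α : Type) : Set (NCSeries α) := exp '' freeLieCompletion α

end NCSeries

namespace KZ4

open NCSeries

/-- The free generators of `𝔣₅`: `none` is `A`, and `some k` is `b[i ^ k]`. -/
abbrev Gen : Type := Option (Fin 4)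

/-- The generator `A`, attached to the pole `0`. -/
def A : NCSeries Gen := X none

/-- The generator `b[i ^ k]`, attached to the pole `i ^ k`. -/
def b (k : Fin 4) : NCSeries Gen := X (some k)

/-- The generator `C = -A - ∑ b[ζ]`, attached to `∞`. -/
def C : NCSeries Gen := -A - ∑ k, b k

/-- The coefficient `A / z + ∑_{ζ ∈ μ₄} b[ζ] / (z - ζ)` of the connection. -/
def connection (z : ℂ) : NCSeries Gen :=
  z⁻¹ • A + ∑ k : Fin 4, (z - Complex.I ^ (k : ℕ))⁻¹ • b k

/-- `H` is a solution on `]0,1[` of `(dH) H⁻¹ = (A / z + ∑ b[ζ] / (z - ζ)) dz`, i.e. it has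
invertible values and `dH / dz = (A / z + ∑ b[ζ] / (z - ζ)) H`, coefficient by coefficient. -/
def IsSolution (H : ℝ → NCSeries Gen) : Prop :=
  ∀ z ∈ Set.Ioo (0 : ℝ) 1, IsUnit (H z) ∧
    ∀ w, HasDerivAt (fun t : ℝ => coeff (H t) w) (coeff (connection z * H z) w) z

/-- `H(z) ≃ z ^ A` when `z → 0⁺`: `H(z) z ^ (-A)` tends to `1`, coefficient by coefficient. -/
def AsympAtZero (H : ℝ → NCSeries Gen) : Prop :=
  ∀ w, Tendsto (fun z : ℝ => coeff (H z * cpow (z : ℂ) (-A)) w) (𝓝[>] 0)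
    (𝓝 (coeff (1 : NCSeries Gen) w))

/-- `H(z) ≃ (1 - z) ^ b[1]` when `z → 1⁻`: `H(z) (1 - z) ^ (-b[1])` tends to `1`, coefficient by
coefficient. -/
def AsympAtOne (H : ℝ → NCSeries Gen) : Prop :=
  ∀ w, Tendsto (fun z : ℝ => coeff (H z * cpow (1 - (z : ℂ)) (-b 0)) w) (𝓝[<] 1)
    (𝓝 (coeff (1 : NCSeries Gen) w))

/-- `Ψ` is the renormalized holonomy `H₁⁻¹ H₀` from `0` to `1`. -/
def IsPsi4 (Ψ : NCSeries Gen) : Prop :=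
  ∃ H₀ H₁ : ℝ → NCSeries Gen,
    IsSolution H₀ ∧ AsympAtZero H₀ ∧ IsSolution H₁ ∧ AsympAtOne H₁ ∧
    ∀ z ∈ Set.Ioo (0 : ℝ) 1, Ψ = Ring.inverse (H₁ z) * H₀ z

/-- The images of the free generators under `s`. As `z ↦ (1 + i z) / (1 - i z)` maps
`0 ↦ 1 ↦ i ↦ 0` and `-1 ↦ -i ↦ ∞ ↦ -1`, these are `A ↦ b[1]`, `b[1] ↦ b[i]`, `b[i] ↦ A`,
`b[-1] ↦ b[-i]`, `b[-i] ↦ C` (and `C ↦ b[-1]` follows). -/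
def sGen : Gen → NCSeries Gen
  | none => b 0
  | some 0 => b 1
  | some 1 => A
  | some 2 => b 3
  | some 3 => C

/-- The automorphism `s`, of order `3`, on the completed algebra. -/
def s (f : NCSeries Gen) : NCSeries Gen := subst sGen f

end KZ4

end

/-!
The equation is solved once, at the pole `0`, and everything else follows by symmetry.

*The solution at `0`.* Writing `H₀ = P z ^ A` turns the equation into `P' = [A, P] / z + R P`, with
`R` the part of the connection that is regular at `0`, and `P(0) = 1`. The coefficient of a word in
`P` is a primitive of an expression in the coefficients of shorter words, in which the pole at `0`
is removable, so that `P` is holomorphic on the unit disc (`regularCoeff_spec`).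

*The solution at `1`.* The inverse `z ↦ i (1 - z) / (1 + z)` of the rotation maps the right half of
the unit disc into the unit disc cut along the negative axis, and it carries the connection to its
image under `s` (`rotInv_connection`). Hence `z ↦ s (H₀ (i (1 - z) / (1 + z)))` is a solution on the
half disc, and comparing branches of the logarithm on the real axis shows that its product by
`(2 / i) ^ b[1]` is the solution `H₁` normalized at `1` (`asympAtOne_oneSolution`). Solutions are
determined by their asymptotics, because a constant whose conjugates by unipotent series tend to
`1` is equal to `1` (`eq_one_of_tendsto_conj`).

*The hexagon relation.* The identity `H₀ = H₁ Ψ` extends to the connected half disc, which contains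
the fixed point of the rotation. There it reads `h = s(h) (2 / i) ^ b[1] Ψ` with `h` the value of
`H₀`, and the images of this identity under `1`, `s`, `s²` combine to the relation since `s³ = 1`
(`hexagon_psi4`).

*Membership in the exponential group.* For the Euler derivation `E`, which multiplies the degree
`n` component by `n`, a series `g` with constant term `1` is the exponential of a Lie series if and
only if `E(g) g⁻¹` is a Lie series (`mem_expFreeLie_iff`): the logarithm is built degree by degree,
and `E` is invertible in positive degrees. Along a solution of the equation, `E(H) H⁻¹` follows a
linear differential equation in the completed Lie algebra, and so stays in it when it starts there
(`mem_freeLieCompletion_of_flow`). To start at a singular point, this is applied to the regularized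
solution (`mem_expFreeLie_of_flow_of_tendsto`).
-/

noncomputable section

namespace NCSeries

/-! ### Coefficients and orders of vanishing -/

section Algebra

variable {α : Type}

/-- Taking the coefficient of `w`, as a linear form. -/
def coeffLinear (w : List α) : NCSeries α →ₗ[ℂ] ℂ where
  toFun f := coeff f w
  map_add' _ _ := rfl
  map_smul' _ _ := rfl

@[simp] theorem coeff_neg (f : NCSeries α) (w : List α) : coeff (-f) w = -coeff f w :=
  map_neg (coeffLinear w) f

@[simp] theorem coeff_sub (f g : NCSeries α) (w : List α) :
    coeff (f - g) w = coeff f w - coeff g w :=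
  map_sub (coeffLinear w) f g

theorem coeff_sum {ι : Type*} (S : Finset ι) (f : ι → NCSeries α) (w : List α) :
    coeff (∑ i ∈ S, f i) w = ∑ i ∈ S, coeff (f i) w :=
  map_sum (coeffLinear w) f S

@[simp] theorem coeff_one_nil : coeff (1 : NCSeries α) [] = 1 := by simp [coeff_one]

theorem coeff_X_nil (a : α) : coeff (X a) [] = 0 := by simp [coeff, X]

/-- The series `f` has only terms of degree at least `n`. -/
def OrderGE (n : ℕ) (f : NCSeries α) : Prop := ∀ w, w.length < n → coeff f w = 0

namespace OrderGE

variable {m n : ℕ} {f g : NCSeries α}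

theorem zero : OrderGE n (0 : NCSeries α) := fun _ _ => rfl

theorem mono (h : OrderGE n f) (hm : m ≤ n) : OrderGE m f := fun w hw => h w (hw.trans_le hm)

theorem add (hf : OrderGE n f) (hg : OrderGE n g) : OrderGE n (f + g) := fun w hw => by
  rw [coeff_add, hf w hw, hg w hw, add_zero]

theorem sub (hf : OrderGE n f) (hg : OrderGE n g) : OrderGE n (f - g) := fun w hw => by
  rw [coeff_sub, hf w hw, hg w hw, sub_zero]

theorem smul (c : ℂ) (hf : OrderGE n f) : OrderGE n (c • f) := fun w hw => by
  rw [coeff_smul, hf w hw, mul_zero]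

theorem sum {ι : Type*} {S : Finset ι} {F : ι → NCSeries α} (h : ∀ i ∈ S, OrderGE n (F i)) :
    OrderGE n (∑ i ∈ S, F i) := fun w hw => by
  rw [coeff_sum]
  exact Finset.sum_eq_zero fun i hi => h i hi w hw

theorem mul (hf : OrderGE m f) (hg : OrderGE n g) : OrderGE (m + n) (f * g) := fun w hw => by
  rw [coeff_mul]
  refine Finset.sum_eq_zero fun k hk => ?_
  rw [Finset.mem_range] at hk
  rcases lt_or_ge k m with h | h
  · rw [hf _ (by rw [List.length_take]; omega), zero_mul]
  · rw [hg _ (by rw [List.length_drop]; omega), mul_zero]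

theorem of_coeff_nil (h : coeff f [] = 0) : OrderGE 1 f := fun w hw => by
  rw [List.length_eq_zero_iff.mp (Nat.lt_one_iff.mp hw), h]

theorem any (f : NCSeries α) : OrderGE 0 f := fun _ hw => absurd hw (Nat.not_lt_zero _)

theorem pow (h : coeff f [] = 0) (k : ℕ) : OrderGE k (f ^ k) := by
  induction k with
  | zero => exact any _
  | succ k ih => exact pow_succ f k ▸ ih.mul (of_coeff_nil h)

/-- Left multiplication by `u` multiplies the leading terms by the constant term of `u`. -/
theorem coeff_mul_left (hf : OrderGE n f) (u : NCSeries α) {w : List α} (hw : w.length ≤ n) :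
    coeff (u * f) w = coeff u [] * coeff f w := by
  rw [coeff_mul, Finset.sum_eq_single_of_mem 0 (by simp)]
  · simp
  · intro k hk hk0
    rw [Finset.mem_range] at hk
    rw [hf _ (by rw [List.length_drop]; omega), mul_zero]

/-- Right multiplication by `u` multiplies the leading terms by the constant term of `u`. -/
theorem coeff_mul_right (hf : OrderGE n f) (u : NCSeries α) {w : List α} (hw : w.length ≤ n) :
    coeff (f * u) w = coeff f w * coeff u [] := by
  rw [coeff_mul, Finset.sum_eq_single_of_mem w.length (by simp)]
  · simp
  · intro k hk hk0
    rw [Finset.mem_range] at hk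
    rw [hf _ (by rw [List.length_take]; omega), zero_mul]

end OrderGE

theorem eq_zero_of_forall_orderGE {f : NCSeries α} (h : ∀ n, OrderGE n f) : f = 0 :=
  NCSeries.ext fun w => h (w.length + 1) w (Nat.lt_succ_self _)

theorem eq_of_forall_orderGE_sub {f g : NCSeries α} (h : ∀ n, OrderGE n (f - g)) : f = g :=
  sub_eq_zero.mp (eq_zero_of_forall_orderGE h)

/-! ### Power series in a series without constant term -/

/-- The series `∑ c k • x ^ k`, for `x` without constant term: the terms with `k > w.length` do
not contribute to the coefficient of `w`. -/
def evalSeries (c : ℕ → ℂ) (x : NCSeries α) : NCSeries α :=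
  fun w => ∑ k ∈ Finset.range (w.length + 1), c k * coeff (x ^ k) w

theorem coeff_evalSeries (c : ℕ → ℂ) (x : NCSeries α) (w : List α) :
    coeff (evalSeries c x) w = ∑ k ∈ Finset.range (w.length + 1), c k * coeff (x ^ k) w := rfl

theorem exp_eq_evalSeries (x : NCSeries α) :
    exp x = evalSeries (fun k => (k.factorial : ℂ)⁻¹) x := rfl

theorem coeff_evalSeries_of_le (c : ℕ → ℂ) {x : NCSeries α} (hx : coeff x [] = 0) {N : ℕ}
    {w : List α} (hw : w.length ≤ N) :
    coeff (evalSeries c x) w = ∑ k ∈ Finset.range (N + 1), c k * coeff (x ^ k) w := by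
  rw [coeff_evalSeries]
  refine Finset.sum_subset (Finset.range_subset_range.mpr (by omega)) fun k _ hk => ?_
  rw [Finset.mem_range] at hk
  rw [OrderGE.pow hx k w (by omega), mul_zero]

theorem orderGE_evalSeries_sub (c : ℕ → ℂ) {x : NCSeries α} (hx : coeff x [] = 0) (N : ℕ) :
    OrderGE (N + 1) (evalSeries c x - ∑ k ∈ Finset.range (N + 1), c k • x ^ k) := fun w hw => by
  rw [coeff_sub, coeff_evalSeries_of_le c hx (Nat.lt_succ_iff.mp hw), coeff_sum]
  simp

theorem coeff_evalSeries_nil (c : ℕ → ℂ) (x : NCSeries α) :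
    coeff (evalSeries c x) [] = c 0 := by
  simp [coeff_evalSeries]

theorem coeff_mul_evalSeries (c : ℕ → ℂ) {x : NCSeries α} (hx : coeff x [] = 0)
    (y : NCSeries α) {N : ℕ} {w : List α} (hw : w.length ≤ N) :
    coeff (y * evalSeries c x) w =
      ∑ k ∈ Finset.range (N + 1), c k * coeff (y * x ^ k) w := by
  have h := (OrderGE.any y).mul (orderGE_evalSeries_sub c hx N) w (by omega)
  rw [mul_sub, coeff_sub, sub_eq_zero, Finset.mul_sum, coeff_sum] at h
  simpa using h

theorem coeff_evalSeries_mul (c : ℕ → ℂ) {x : NCSeries α} (hx : coeff x [] = 0)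
    (y : NCSeries α) {N : ℕ} {w : List α} (hw : w.length ≤ N) :
    coeff (evalSeries c x * y) w =
      ∑ k ∈ Finset.range (N + 1), c k * coeff (x ^ k * y) w := by
  have h := (orderGE_evalSeries_sub c hx N).mul (OrderGE.any y) w (by omega)
  rw [sub_mul, coeff_sub, sub_eq_zero, Finset.sum_mul, coeff_sum] at h
  simpa using h

theorem commute_evalSeries (c : ℕ → ℂ) {x y : NCSeries α} (hx : coeff x [] = 0)
    (h : Commute y x) : Commute y (evalSeries c x) := by
  ext w
  rw [coeff_mul_evalSeries c hx y le_rfl, coeff_evalSeries_mul c hx y le_rfl]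
  simp only [(h.pow_right _).eq]

@[simp] theorem coeff_exp_nil (x : NCSeries α) : coeff (exp x) [] = 1 := by
  rw [exp_eq_evalSeries, coeff_evalSeries_nil]
  simp

@[simp] theorem exp_zero : exp (0 : NCSeries α) = 1 := by
  ext w
  rw [exp_eq_evalSeries, coeff_evalSeries, Finset.sum_eq_single_of_mem 0 (by simp)]
  · simp
  · intro k _ hk
    simp [zero_pow hk]

theorem commute_exp {x y : NCSeries α} (hx : coeff x [] = 0) (h : Commute y x) :
    Commute y (exp x) := commute_evalSeries _ hx h

/-- If `h` starts in degree `n + 1`, then `exp (x + h)` and `exp x + h` agree up to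
degree `n + 1`. -/
theorem orderGE_exp_add_sub {x h : NCSeries α} (hx : coeff x [] = 0) {n : ℕ}
    (hh : OrderGE (n + 1) h) : OrderGE (n + 2) (exp (x + h) - (exp x + h)) := by
  have hh0 : coeff h [] = 0 := hh [] (by simp)
  have hxh : coeff (x + h) [] = 0 := by rw [coeff_add, hx, hh0, add_zero]
  have key : ∀ k, OrderGE (n + 1 + k) ((x + h) ^ (k + 1) - x ^ (k + 1)) := by
    intro k
    induction k with
    | zero => simpa using hh
    | succ k ih =>
      have e : (x + h) ^ (k + 1 + 1) - x ^ (k + 1 + 1) =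
          ((x + h) ^ (k + 1) - x ^ (k + 1)) * (x + h) + x ^ (k + 1) * h := by
        rw [pow_succ (x + h), pow_succ x (k + 1)]
        noncomm_ring
      rw [e]
      refine ((ih.mul (OrderGE.of_coeff_nil hxh)).mono (by omega)).add ?_
      exact ((OrderGE.pow hx (k + 1)).mul hh).mono (by omega)
  have e : exp (x + h) - (exp x + h) =
      (exp (x + h) - ∑ k ∈ Finset.range (n + 3), (k.factorial : ℂ)⁻¹ • (x + h) ^ k)
      - (exp x - ∑ k ∈ Finset.range (n + 3), (k.factorial : ℂ)⁻¹ • x ^ k)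
      + ∑ k ∈ Finset.range (n + 1), ((k + 2).factorial : ℂ)⁻¹ •
          ((x + h) ^ (k + 2) - x ^ (k + 2)) := by
    have s : ∀ y : NCSeries α, ∑ k ∈ Finset.range (n + 3), (k.factorial : ℂ)⁻¹ • y ^ k =
        ∑ k ∈ Finset.range (n + 1), ((k + 2).factorial : ℂ)⁻¹ • y ^ (k + 2) + y + 1 := by
      intro y
      rw [Finset.sum_range_succ', Finset.sum_range_succ']
      simp [add_assoc]
    rw [s, s]
    simp only [smul_sub, Finset.sum_sub_distrib]
    abel
  rw [e]
  refine (((orderGE_evalSeries_sub _ hxh (n + 2)).mono (by omega)).sub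
    ((orderGE_evalSeries_sub _ hx (n + 2)).mono (by omega))).add ?_
  exact OrderGE.sum fun k _ => OrderGE.smul _ ((key (k + 1)).mono (by omega))

/-! ### Inverses of series with constant term `1` -/

theorem coeff_one_sub_nil {g : NCSeries α} (hg : coeff g [] = 1) : coeff (1 - g) [] = 0 := by
  rw [coeff_sub, hg, coeff_one_nil, sub_self]

theorem mul_evalSeries_one_sub {g : NCSeries α} (hg : coeff g [] = 1) :
    g * evalSeries (fun _ => 1) (1 - g) = 1 := by
  have hx := coeff_one_sub_nil hg
  refine eq_of_forall_orderGE_sub fun n => ?_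
  have e : g * evalSeries (fun _ => 1) (1 - g) - 1 =
      g * (evalSeries (fun _ => 1) (1 - g) - ∑ k ∈ Finset.range (n + 1), (1 : ℂ) • (1 - g) ^ k)
        - (1 - g) ^ (n + 1) := by
    have := mul_neg_geom_sum (1 - g) (n + 1)
    rw [sub_sub_cancel] at this
    simp only [one_smul, mul_sub, this]
    abel
  rw [e]
  refine ((OrderGE.any g).mul (orderGE_evalSeries_sub _ hx n) |>.mono (by omega)).sub
    ((OrderGE.pow hx (n + 1)).mono (by omega))

theorem evalSeries_one_sub_mul {g : NCSeries α} (hg : coeff g [] = 1) :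
    evalSeries (fun _ => 1) (1 - g) * g = 1 := by
  have h : Commute g (evalSeries (fun _ => 1) (1 - g)) :=
    commute_evalSeries _ (coeff_one_sub_nil hg)
      ((Commute.one_right g).sub_right (Commute.refl g))
  rw [← h.eq, mul_evalSeries_one_sub hg]

theorem isUnit_of_coeff_nil {g : NCSeries α} (hg : coeff g [] = 1) : IsUnit g :=
  ⟨⟨g, _, mul_evalSeries_one_sub hg, evalSeries_one_sub_mul hg⟩, rfl⟩

theorem inverse_eq_evalSeries {g : NCSeries α} (hg : coeff g [] = 1) :
    Ring.inverse g = evalSeries (fun _ => 1) (1 - g) :=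
  Ring.inverse_unit ⟨g, _, mul_evalSeries_one_sub hg, evalSeries_one_sub_mul hg⟩

theorem mul_inverse {g : NCSeries α} (hg : coeff g [] = 1) : g * Ring.inverse g = 1 :=
  Ring.mul_inverse_cancel g (isUnit_of_coeff_nil hg)

theorem inverse_mul {g : NCSeries α} (hg : coeff g [] = 1) : Ring.inverse g * g = 1 :=
  Ring.inverse_mul_cancel g (isUnit_of_coeff_nil hg)

theorem coeff_inverse_nil {g : NCSeries α} (hg : coeff g [] = 1) :
    coeff (Ring.inverse g) [] = 1 := by
  rw [inverse_eq_evalSeries hg, coeff_evalSeries_nil]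

theorem inverse_eq_of_mul_eq_one {g h : NCSeries α} (hg : coeff g [] = 1) (e : g * h = 1) :
    Ring.inverse g = h := by
  rw [← mul_one (Ring.inverse g), ← e, ← mul_assoc, inverse_mul hg, one_mul]

theorem coeff_mul_nil_eq_one {g h : NCSeries α} (hg : coeff g [] = 1) (hh : coeff h [] = 1) :
    coeff (g * h) [] = 1 := by rw [coeff_mul_nil, hg, hh, one_mul]

theorem inverse_mul_rev {g h : NCSeries α} (hg : coeff g [] = 1) (hh : coeff h [] = 1) :
    Ring.inverse (g * h) = Ring.inverse h * Ring.inverse g := by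
  refine inverse_eq_of_mul_eq_one (coeff_mul_nil_eq_one hg hh) ?_
  rw [mul_assoc, ← mul_assoc h, mul_inverse hh, one_mul, mul_inverse hg]

/-! ### The Euler derivation and the homogeneous components -/

/-- The Euler derivation, which multiplies the homogeneous component of degree `n` by `n`. -/
def euler : NCSeries α →ₗ[ℂ] NCSeries α where
  toFun f := fun w => (w.length : ℂ) * coeff f w
  map_add' f g := by
    ext w
    exact mul_add _ _ _
  map_smul' c f := by
    ext w
    exact mul_left_comm _ _ _

theorem coeff_euler (f : NCSeries α) (w : List α) :
    coeff (euler f) w = (w.length : ℂ) * coeff f w := rfl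

theorem euler_mul (f g : NCSeries α) : euler (f * g) = euler f * g + f * euler g := by
  ext w
  rw [coeff_add, coeff_euler, coeff_mul, coeff_mul, coeff_mul, ← Finset.sum_add_distrib,
    Finset.mul_sum]
  refine Finset.sum_congr rfl fun k hk => ?_
  rw [Finset.mem_range] at hk
  rw [coeff_euler, coeff_euler, List.length_take, List.length_drop, min_eq_left (by omega),
    Nat.cast_sub (by omega)]
  ring

theorem euler_one : euler (1 : NCSeries α) = 0 := by
  ext w
  cases w <;> simp [coeff_euler, coeff_one]

/-- The projection onto the homogeneous component of degree `n`. -/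
def homogeneousPartLinear (n : ℕ) : NCSeries α →ₗ[ℂ] NCSeries α where
  toFun := homogeneousPart n
  map_add' f g := by
    funext w
    show (if w.length = n then coeff f w + coeff g w else 0) =
      (if w.length = n then coeff f w else 0) + (if w.length = n then coeff g w else 0)
    split_ifs <;> simp
  map_smul' c f := by
    funext w
    show (if w.length = n then c * coeff f w else 0) =
      c * (if w.length = n then coeff f w else 0)
    split_ifs <;> simp

theorem homogeneousPartLinear_apply (n : ℕ) (f : NCSeries α) :
    homogeneousPartLinear n f = homogeneousPart n f := rfl

theorem coeff_homogeneousPart (n : ℕ) (f : NCSeries α) (w : List α) :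
    coeff (homogeneousPart n f) w = if w.length = n then coeff f w else 0 := rfl

theorem homogeneousPart_add (n : ℕ) (f g : NCSeries α) :
    homogeneousPart n (f + g) = homogeneousPart n f + homogeneousPart n g :=
  map_add (homogeneousPartLinear n) f g

theorem homogeneousPart_sub (n : ℕ) (f g : NCSeries α) :
    homogeneousPart n (f - g) = homogeneousPart n f - homogeneousPart n g :=
  map_sub (homogeneousPartLinear n) f g

theorem homogeneousPart_smul (n : ℕ) (c : ℂ) (f : NCSeries α) :
    homogeneousPart n (c • f) = c • homogeneousPart n f :=
  map_smul (homogeneousPartLinear n) c f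

theorem homogeneousPart_euler (n : ℕ) (f : NCSeries α) :
    homogeneousPart n (euler f) = (n : ℂ) • homogeneousPart n f := by
  ext w
  rw [coeff_smul, coeff_homogeneousPart, coeff_homogeneousPart, coeff_euler]
  split_ifs with h
  · rw [h]
  · rw [mul_zero]

theorem homogeneousPart_homogeneousPart (m n : ℕ) (f : NCSeries α) :
    homogeneousPart m (homogeneousPart n f) = if m = n then homogeneousPart n f else 0 := by
  ext w
  rw [coeff_homogeneousPart]
  by_cases h : m = n
  · subst h
    rw [if_pos rfl, coeff_homogeneousPart]
    split_ifs <;> rfl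
  · rw [if_neg h, coeff_homogeneousPart, coeff_zero]
    split_ifs <;> first | rfl | omega

theorem homogeneousPart_mul (n : ℕ) (f g : NCSeries α) :
    homogeneousPart n (f * g) =
      ∑ p ∈ Finset.HasAntidiagonal.antidiagonal n,
        homogeneousPart p.1 f * homogeneousPart p.2 g := by
  ext w
  rw [coeff_homogeneousPart, coeff_sum]
  simp only [coeff_mul, coeff_homogeneousPart]
  rw [Finset.sum_comm]
  by_cases hn : w.length = n
  · rw [if_pos hn]
    refine Finset.sum_congr rfl fun k hk => ?_
    rw [Finset.mem_range] at hk
    rw [Finset.sum_eq_single_of_mem (k, n - k)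
      (by rw [Finset.HasAntidiagonal.mem_antidiagonal]; omega)]
    · rw [if_pos (by rw [List.length_take]; omega), if_pos (by rw [List.length_drop]; omega)]
    · rintro ⟨i, j⟩ hij hne
      rw [Finset.HasAntidiagonal.mem_antidiagonal] at hij
      rw [if_neg, zero_mul]
      rw [List.length_take]
      intro h
      apply hne
      simp only [Prod.mk.injEq]
      omega
  · rw [if_neg hn]
    symm
    refine Finset.sum_eq_zero fun k hk => Finset.sum_eq_zero ?_
    rintro ⟨i, j⟩ hij
    rw [Finset.HasAntidiagonal.mem_antidiagonal] at hij
    rw [Finset.mem_range] at hk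
    by_cases h1 : (w.take k).length = i
    · rw [if_neg (c := (w.drop k).length = j), mul_zero]
      rw [List.length_take] at h1
      rw [List.length_drop]
      omega
    · rw [if_neg h1, zero_mul]

theorem orderGE_homogeneousPart (n : ℕ) (f : NCSeries α) :
    OrderGE n (homogeneousPart n f) := fun w hw => by
  rw [coeff_homogeneousPart, if_neg hw.ne]

end Algebra

/-! ### Coefficientwise limits -/

section Limits

variable {α : Type} {ι : Type*} {l : Filter ι}

/-- Convergence coefficient by coefficient. -/
def TendstoCoeff (F : ι → NCSeries α) (l : Filter ι) (f : NCSeries α) : Prop :=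
  ∀ w, Tendsto (fun t => coeff (F t) w) l (𝓝 (coeff f w))

namespace TendstoCoeff

variable {F G : ι → NCSeries α} {f g : NCSeries α}

theorem const (f : NCSeries α) : TendstoCoeff (fun _ => f) l f := fun _ => tendsto_const_nhds

theorem congr' (h : TendstoCoeff F l f) (e : ∀ᶠ t in l, F t = G t) : TendstoCoeff G l f :=
  fun w => (h w).congr' (e.mono fun t ht => by rw [ht])

theorem sub (hf : TendstoCoeff F l f) (hg : TendstoCoeff G l g) :
    TendstoCoeff (fun t => F t - G t) l (f - g) := fun w => by
  simpa only [coeff_sub] using (hf w).sub (hg w)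

theorem mul (hf : TendstoCoeff F l f) (hg : TendstoCoeff G l g) :
    TendstoCoeff (fun t => F t * G t) l (f * g) := fun w => by
  simp only [coeff_mul]
  exact tendsto_finsetSum _ fun k _ => (hf _).mul (hg _)

theorem pow (hf : TendstoCoeff F l f) (k : ℕ) : TendstoCoeff (fun t => F t ^ k) l (f ^ k) := by
  induction k with
  | zero => simpa only [pow_zero] using const 1
  | succ k ih => simpa only [pow_succ] using ih.mul hf

theorem evalSeries (c : ℕ → ℂ) (hf : TendstoCoeff F l f) :
    TendstoCoeff (fun t => evalSeries c (F t)) l (evalSeries c f) := fun w => by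
  simp only [coeff_evalSeries]
  exact tendsto_finsetSum _ fun k _ => (hf.pow k w).const_mul _

theorem inverse (h1 : ∀ᶠ t in l, coeff (F t) [] = 1) (hf1 : coeff f [] = 1)
    (hf : TendstoCoeff F l f) :
    TendstoCoeff (fun t => Ring.inverse (F t)) l (Ring.inverse f) := by
  rw [inverse_eq_evalSeries hf1]
  exact (((const 1).sub hf).evalSeries _).congr'
    (h1.mono fun t ht => (inverse_eq_evalSeries ht).symm)

theorem euler (hf : TendstoCoeff F l f) :
    TendstoCoeff (fun t => euler (F t)) l (NCSeries.euler f) := fun w =>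
  (hf w).const_mul (w.length : ℂ)

end TendstoCoeff

/-- A series `c` whose conjugates by unipotent series tend to `1` is equal to `1`: the term of
lowest degree of `c - 1` is invariant under conjugation. -/
theorem eq_one_of_tendsto_conj [l.NeBot] {g : ι → NCSeries α} {c : NCSeries α}
    (hg : ∀ t, coeff (g t) [] = 1)
    (h : TendstoCoeff (fun t => Ring.inverse (g t) * c * g t) l 1) : c = 1 := by
  have h' : TendstoCoeff (fun t => Ring.inverse (g t) * (c - 1) * g t) l 0 := by
    have := h.sub (TendstoCoeff.const 1)
    rw [sub_self] at this
    refine this.congr' (Eventually.of_forall fun t => ?_)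
    rw [mul_sub, sub_mul, mul_one, inverse_mul (hg t)]
  refine eq_of_forall_orderGE_sub fun n => ?_
  induction n with
  | zero => exact OrderGE.any _
  | succ n ih =>
    intro w hw
    refine tendsto_nhds_unique (f := fun _ : ι => coeff (c - 1) w) (l := l)
      tendsto_const_nhds ((h' w).congr fun t => ?_)
    have h1 : OrderGE n (Ring.inverse (g t) * (c - 1)) :=
      ((OrderGE.any _).mul ih).mono (by omega)
    rw [h1.coeff_mul_right _ (by omega), ih.coeff_mul_left _ (by omega), hg t,
      coeff_inverse_nil (hg t), one_mul, mul_one]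

end Limits

/-! ### Coefficientwise derivatives -/

section Deriv

variable {α : Type} {𝕜 : Type*} [NontriviallyNormedField 𝕜] [NormedAlgebra 𝕜 ℂ]

/-- Differentiability coefficient by coefficient. -/
def HasCoeffDerivAt (F : 𝕜 → NCSeries α) (f' : NCSeries α) (x : 𝕜) : Prop :=
  ∀ w, HasDerivAt (fun t => coeff (F t) w) (coeff f' w) x

namespace HasCoeffDerivAt

variable {F G : 𝕜 → NCSeries α} {f' g' : NCSeries α} {x : 𝕜}

theorem const (f : NCSeries α) (x : 𝕜) : HasCoeffDerivAt (fun _ => f) 0 x :=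
  fun _ => hasDerivAt_const _ _

theorem congr_deriv (hf : HasCoeffDerivAt F f' x) (h : f' = g') : HasCoeffDerivAt F g' x :=
  h ▸ hf

theorem unique (hf : HasCoeffDerivAt F f' x) (hg : HasCoeffDerivAt F g' x) : f' = g' :=
  NCSeries.ext fun w => (hf w).unique (hg w)

theorem sub (hf : HasCoeffDerivAt F f' x) (hg : HasCoeffDerivAt G g' x) :
    HasCoeffDerivAt (fun t => F t - G t) (f' - g') x := fun w => by
  simpa only [coeff_sub] using (hf w).fun_sub (hg w)

theorem mul (hf : HasCoeffDerivAt F f' x) (hg : HasCoeffDerivAt G g' x) :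
    HasCoeffDerivAt (fun t => F t * G t) (f' * G x + F x * g') x := fun w => by
  simp only [coeff_mul, coeff_add, ← Finset.sum_add_distrib]
  exact HasDerivAt.fun_sum fun k _ => (hf _).mul (hg _)

theorem mul_const (hf : HasCoeffDerivAt F f' x) (g : NCSeries α) :
    HasCoeffDerivAt (fun t => F t * g) (f' * g) x :=
  (hf.mul (const g x)).congr_deriv (by rw [mul_zero, add_zero])

theorem exists_pow (hf : HasCoeffDerivAt F f' x) (k : ℕ) :
    ∃ g', HasCoeffDerivAt (fun t => F t ^ k) g' x := by
  induction k with
  | zero => exact ⟨0, by simpa only [pow_zero] using const 1 x⟩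
  | succ k ih =>
    obtain ⟨g', hg⟩ := ih
    exact ⟨_, by simpa only [pow_succ] using hg.mul hf⟩

/-- The inverse is a polynomial expression in finitely many coefficients, hence differentiable, and
its derivative is then given by the Leibniz rule. -/
theorem inverse (h1 : ∀ t, coeff (F t) [] = 1) (hf : HasCoeffDerivAt F f' x) :
    HasCoeffDerivAt (fun t => Ring.inverse (F t))
      (-(Ring.inverse (F x) * f' * Ring.inverse (F x))) x := by
  obtain ⟨g', hg⟩ : ∃ g', HasCoeffDerivAt (fun t => Ring.inverse (F t)) g' x := by
    choose p hp using fun k => ((const 1 x).sub hf).exists_pow k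
    refine ⟨fun w => ∑ k ∈ Finset.range (w.length + 1), (1 : ℂ) * coeff (p k) w, fun w => ?_⟩
    simp only [inverse_eq_evalSeries (h1 _), coeff_evalSeries]
    exact HasDerivAt.fun_sum fun k _ => (hp k w).const_mul 1
  refine hg.congr_deriv ?_
  have h := (hf.mul hg).unique (by simpa only [mul_inverse (h1 _)] using const 1 x)
  have h2 : F x * g' = -(f' * Ring.inverse (F x)) := eq_neg_of_add_eq_zero_right h
  rw [← one_mul g', ← inverse_mul (h1 x), mul_assoc, h2, mul_neg, mul_assoc]

theorem euler (hf : HasCoeffDerivAt F f' x) :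
    HasCoeffDerivAt (fun t => euler (F t)) (NCSeries.euler f') x := fun w =>
  (hf w).const_mul (w.length : ℂ)

theorem tendstoCoeff (hf : HasCoeffDerivAt F f' x) : TendstoCoeff F (𝓝 x) (F x) :=
  fun w => (hf w).continuousAt

theorem comp_ofReal {F : ℂ → NCSeries α} {x : ℝ} (hf : HasCoeffDerivAt F f' (x : ℂ)) :
    HasCoeffDerivAt (fun t : ℝ => F (t : ℂ)) f' x := fun w => (hf w).comp_ofReal

theorem comp {F : ℂ → NCSeries α} {φ : ℂ → ℂ} {φ' z : ℂ} (hf : HasCoeffDerivAt F f' (φ z))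
    (hφ : HasDerivAt φ φ' z) : HasCoeffDerivAt (fun t => F (φ t)) (φ' • f') z := fun w => by
  rw [coeff_smul, mul_comm]
  exact (hf w).comp z hφ

end HasCoeffDerivAt

/-- Along `∂H = Ω H`, for `H` unipotent, the inverse satisfies `∂H⁻¹ = -H⁻¹ Ω`. -/
theorem HasCoeffDerivAt.inverse_of_flow {F : 𝕜 → NCSeries α} {ω : NCSeries α} {x : 𝕜}
    (h1 : ∀ t, coeff (F t) [] = 1) (hf : HasCoeffDerivAt F (ω * F x) x) :
    HasCoeffDerivAt (fun t => Ring.inverse (F t)) (-(Ring.inverse (F x) * ω)) x :=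
  (HasCoeffDerivAt.inverse h1 hf).congr_deriv (by
    rw [mul_assoc, mul_assoc ω, mul_inverse (h1 x), mul_one])

end Deriv

section Flow

variable {α : Type} {𝕜 : Type*} [RCLike 𝕜] [NormedAlgebra 𝕜 ℂ]

theorem eq_of_coeffDeriv_eq_zero {D : Set 𝕜} (hD : IsOpen D) (hD' : IsPreconnected D)
    {F : 𝕜 → NCSeries α} (h : ∀ t ∈ D, HasCoeffDerivAt F 0 t) {x y : 𝕜} (hx : x ∈ D)
    (hy : y ∈ D) : F x = F y := by
  ext w
  obtain ⟨a, ha⟩ := hD.exists_is_const_of_deriv_eq_zero hD' (f := fun t => coeff (F t) w)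
    (fun t ht => (h t ht w).differentiableAt.differentiableWithinAt)
    (fun t ht => (h t ht w).deriv)
  exact (ha x hx).trans (ha y hy).symm

/-- Two solutions of `∂H = Ω H` on a connected open set differ by a constant right factor. -/
theorem inverse_mul_eq_of_flow {D : Set 𝕜} (hD : IsOpen D) (hD' : IsPreconnected D)
    {F G : 𝕜 → NCSeries α} {ω : 𝕜 → NCSeries α} (h1 : ∀ t, coeff (F t) [] = 1)
    (hF : ∀ t ∈ D, HasCoeffDerivAt F (ω t * F t) t)
    (hG : ∀ t ∈ D, HasCoeffDerivAt G (ω t * G t) t) {x y : 𝕜} (hx : x ∈ D) (hy : y ∈ D) :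
    Ring.inverse (F x) * G x = Ring.inverse (F y) * G y := by
  refine eq_of_coeffDeriv_eq_zero hD hD' (F := fun t => Ring.inverse (F t) * G t)
    (fun t ht => ?_) hx hy
  refine (((hF t ht).inverse_of_flow h1).mul (hG t ht)).congr_deriv ?_
  rw [neg_mul, mul_assoc, neg_add_cancel]

end Flow

/-! ### The exponential -/

section Exp

variable {α : Type}

theorem coeff_smul_nil {x : NCSeries α} (hx : coeff x [] = 0) (c : ℂ) :
    coeff (c • x) [] = 0 := by rw [coeff_smul, hx, mul_zero]

theorem hasCoeffDerivAt_exp {x : NCSeries α} (hx : coeff x [] = 0) (c : ℂ) :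
    HasCoeffDerivAt (fun t : ℂ => exp (t • x)) (x * exp (c • x)) c := fun w => by
  rw [exp_eq_evalSeries, coeff_mul_evalSeries _ (coeff_smul_nil hx c) x (le_refl w.length),
    Finset.sum_range_succ]
  simp only [smul_pow, mul_smul_comm, coeff_smul, ← pow_succ', exp_eq_evalSeries,
    coeff_evalSeries]
  rw [OrderGE.pow hx (w.length + 1) w (Nat.lt_succ_self _), mul_zero, mul_zero, add_zero]
  have h : ∀ k ∈ Finset.range (w.length + 1),
      HasDerivAt (fun t : ℂ => (k.factorial : ℂ)⁻¹ * (t ^ k * coeff (x ^ k) w))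
        ((k.factorial : ℂ)⁻¹ * ((k : ℂ) * c ^ (k - 1) * coeff (x ^ k) w)) c :=
    fun k _ => ((hasDerivAt_pow k c).mul_const _).const_mul _
  refine (HasDerivAt.fun_sum h).congr_deriv ?_
  rw [Finset.sum_range_succ']
  simp only [Nat.cast_zero, zero_mul, mul_zero, add_zero, Nat.add_sub_cancel]
  refine Finset.sum_congr rfl fun k _ => ?_
  have h1 : (k.factorial : ℂ) ≠ 0 := by exact_mod_cast k.factorial_ne_zero
  have h2 : ((k : ℂ) + 1) ≠ 0 := by exact_mod_cast k.succ_ne_zero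
  rw [Nat.factorial_succ]
  push_cast
  field_simp

theorem commute_exp_smul {x : NCSeries α} (hx : coeff x [] = 0) (c : ℂ) :
    Commute x (exp (c • x)) :=
  commute_exp (coeff_smul_nil hx c) ((Commute.refl x).smul_right c)

/-- The product `exp (t x) exp ((a + b - t) x)` has derivative `0` in `t`. -/
theorem exp_add_smul {x : NCSeries α} (hx : coeff x [] = 0) (a b : ℂ) :
    exp ((a + b) • x) = exp (a • x) * exp (b • x) := by
  have h : ∀ t ∈ (Set.univ : Set ℂ),
      HasCoeffDerivAt (fun t : ℂ => exp (t • x) * exp ((a + b - t) • x)) 0 t := by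
    intro t _
    have h1 : HasDerivAt (fun t : ℂ => a + b - t) (-1) t := by
      simpa using (hasDerivAt_id t).const_sub (a + b)
    refine ((hasCoeffDerivAt_exp hx t).mul
      ((hasCoeffDerivAt_exp hx _).comp h1)).congr_deriv ?_
    rw [neg_one_smul, mul_neg, ← mul_assoc, (commute_exp_smul hx t).eq, add_neg_cancel]
  have := eq_of_coeffDeriv_eq_zero isOpen_univ isPreconnected_univ h (Set.mem_univ 0)
    (Set.mem_univ a)
  simpa using this

theorem exp_mul_exp_neg {x : NCSeries α} (hx : coeff x [] = 0) : exp x * exp (-x) = 1 := by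
  have h := exp_add_smul hx 1 (-1)
  simpa using h.symm

theorem exp_neg_mul_exp {x : NCSeries α} (hx : coeff x [] = 0) : exp (-x) * exp x = 1 := by
  have h := exp_add_smul hx (-1) 1
  simpa using h.symm

theorem inverse_exp {x : NCSeries α} (hx : coeff x [] = 0) :
    Ring.inverse (exp x) = exp (-x) :=
  inverse_eq_of_mul_eq_one (coeff_exp_nil x) (exp_mul_exp_neg hx)

end Exp

/-! ### The completed free Lie algebra -/

section Lie

variable {α : Type}

/-- The free Lie algebra on `α`, inside the noncommutative series. -/
abbrev freeLieRange (α : Type) : LieSubalgebra ℂ (NCSeries α) :=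
  (FreeLieAlgebra.lift ℂ (X : α → NCSeries α)).range

theorem X_mem_freeLieRange (a : α) : X a ∈ freeLieRange α :=
  ⟨FreeLieAlgebra.of ℂ a, by simp⟩

theorem coeff_nil_of_mem_freeLieRange {x : NCSeries α} (hx : x ∈ freeLieRange α) :
    coeff x [] = 0 := by
  -- the constant term is a Lie morphism to the abelian `ℂ`, and vanishes on the generators
  let _ : LieRing ℂ := LieRing.ofAssociativeRing
  let φ : NCSeries α →ₗ⁅ℂ⁆ ℂ :=
    { coeffLinear [] with
      map_lie' := by
        intro x y
        show coeff (x * y - y * x) [] = coeff x [] * coeff y [] - coeff y [] * coeff x []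
        rw [coeff_sub, coeff_mul_nil, coeff_mul_nil] }
  have h : φ.comp (FreeLieAlgebra.lift ℂ (X : α → NCSeries α)) = 0 := by
    apply FreeLieAlgebra.hom_ext
    intro a
    show φ (FreeLieAlgebra.lift ℂ X (FreeLieAlgebra.of ℂ a)) = 0
    rw [FreeLieAlgebra.lift_of_apply]
    exact coeff_X_nil a
  obtain ⟨y, rfl⟩ := hx
  exact congrArg (fun ψ : FreeLieAlgebra ℂ α →ₗ⁅ℂ⁆ ℂ => ψ y) h

theorem add_mem_freeLieCompletion {x y : NCSeries α} (hx : x ∈ freeLieCompletion α)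
    (hy : y ∈ freeLieCompletion α) : x + y ∈ freeLieCompletion α := fun n => by
  rw [homogeneousPart_add]
  exact add_mem (hx n) (hy n)

theorem smul_mem_freeLieCompletion (c : ℂ) {x : NCSeries α} (hx : x ∈ freeLieCompletion α) :
    c • x ∈ freeLieCompletion α := fun n => by
  rw [homogeneousPart_smul]
  exact (freeLieRange α).smul_mem c (hx n)

theorem zero_mem_freeLieCompletion : (0 : NCSeries α) ∈ freeLieCompletion α := fun n => by
  rw [← homogeneousPartLinear_apply, map_zero]
  exact zero_mem _

theorem neg_mem_freeLieCompletion {x : NCSeries α} (hx : x ∈ freeLieCompletion α) :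
    -x ∈ freeLieCompletion α := by
  simpa using smul_mem_freeLieCompletion (-1) hx

theorem sum_mem_freeLieCompletion {ι : Type*} (S : Finset ι) {x : ι → NCSeries α}
    (hx : ∀ i ∈ S, x i ∈ freeLieCompletion α) : ∑ i ∈ S, x i ∈ freeLieCompletion α := by
  classical
  induction S using Finset.induction_on with
  | empty => simpa using zero_mem_freeLieCompletion
  | insert i S hi ih =>
    rw [Finset.sum_insert hi]
    exact add_mem_freeLieCompletion (hx i (Finset.mem_insert_self i S))
      (ih fun j hj => hx j (Finset.mem_insert_of_mem hj))

theorem X_mem_freeLieCompletion (a : α) : X a ∈ freeLieCompletion α := fun n => by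
  have h : homogeneousPart n (X a) = if n = 1 then X a else 0 := by
    ext w
    rw [coeff_homogeneousPart]
    by_cases hw : w = [a]
    · subst hw
      by_cases hn : n = 1
      · simp [hn]
      · simp [hn, Ne.symm hn]
    · have h0 : coeff (X a) w = 0 := if_neg hw
      rw [h0, ite_self]
      split_ifs
      · exact h0.symm
      · rfl
  rw [h]
  split_ifs
  · exact X_mem_freeLieRange a
  · exact zero_mem _

theorem homogeneousPart_zero_of_mem {x : NCSeries α} (hx : x ∈ freeLieCompletion α) :
    homogeneousPart 0 x = 0 := by
  ext w
  rw [coeff_homogeneousPart]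
  split_ifs with h
  · rw [List.length_eq_zero_iff] at h
    subst h
    exact coeff_nil_of_mem_freeLieRange (x := homogeneousPart 0 x) (hx 0)
  · rfl

theorem coeff_nil_of_mem_freeLieCompletion {x : NCSeries α} (hx : x ∈ freeLieCompletion α) :
    coeff x [] = 0 :=
  coeff_nil_of_mem_freeLieRange (x := homogeneousPart 0 x) (hx 0)

theorem euler_mem_freeLieCompletion {x : NCSeries α} (hx : x ∈ freeLieCompletion α) :
    euler x ∈ freeLieCompletion α := fun n => by
  rw [homogeneousPart_euler]
  exact (freeLieRange α).smul_mem _ (hx n)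

theorem homogeneousPart_commutator (n : ℕ) (x y : NCSeries α) :
    homogeneousPart n (x * y - y * x) =
      ∑ p ∈ Finset.HasAntidiagonal.antidiagonal n,
        ⁅homogeneousPart p.1 x, homogeneousPart p.2 y⁆ := by
  rw [homogeneousPart_sub, homogeneousPart_mul, homogeneousPart_mul n y x,
    ← Finset.Nat.sum_antidiagonal_swap (n := n)
      (f := fun p => homogeneousPart p.1 y * homogeneousPart p.2 x), ← Finset.sum_sub_distrib]
  rfl

/-- The component of degree `n` of `[x, y]`, for `x` a Lie series, only involves the components
of `y` of degrees less than `n`. -/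
theorem homogeneousPart_commutator_mem {n : ℕ} {x y : NCSeries α}
    (hx : x ∈ freeLieCompletion α)
    (hy : ∀ m < n, homogeneousPart m y ∈ freeLieRange α) :
    homogeneousPart n (x * y - y * x) ∈ freeLieRange α := by
  rw [homogeneousPart_commutator]
  refine sum_mem ?_
  rintro ⟨i, j⟩ hij
  rw [Finset.HasAntidiagonal.mem_antidiagonal] at hij
  simp only at hij ⊢
  rcases Nat.eq_zero_or_pos i with rfl | hi
  · rw [homogeneousPart_zero_of_mem hx, zero_lie]
    exact zero_mem _
  · exact (freeLieRange α).lie_mem (hx i) (hy j (by omega))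

open Classical in
/-- The series with the single term `w`. -/
def single (w : List α) : NCSeries α := fun u => if u = w then 1 else 0

open Classical in
theorem coeff_single (u w : List α) : coeff (single w) u = if u = w then 1 else 0 := rfl

theorem homogeneousPart_eq_sum [Fintype α] (n : ℕ) (x : NCSeries α) :
    homogeneousPart n x = ∑ v : Fin n → α,
      coeff x (List.ofFn v) • single (List.ofFn v) := by
  ext w
  rw [coeff_homogeneousPart, coeff_sum]
  simp only [coeff_smul, coeff_single]
  split_ifs with h
  · subst h
    rw [Finset.sum_eq_single_of_mem w.get (Finset.mem_univ _)]
    · rw [List.ofFn_get, if_pos rfl, mul_one]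
    · intro v _ hv
      rw [if_neg, mul_zero]
      intro hw
      apply hv
      apply List.ofFn_injective
      rw [List.ofFn_get, ← hw]
  · symm
    refine Finset.sum_eq_zero fun v _ => ?_
    rw [if_neg, mul_zero]
    rintro rfl
    exact h (List.length_ofFn)

/-- A linear form on the component of degree `n` is a finite combination of coefficients. -/
theorem exists_linearForm_homogeneousPart [Fintype α] (n : ℕ) (f : NCSeries α →ₗ[ℂ] ℂ) :
    ∃ c : (Fin n → α) → ℂ, ∀ x : NCSeries α,
      f (homogeneousPart n x) = ∑ v, coeff x (List.ofFn v) * c v := by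
  refine ⟨fun v => f (single (List.ofFn v)), fun x => ?_⟩
  rw [homogeneousPart_eq_sum, map_sum]
  simp only [map_smul, smul_eq_mul]

theorem mem_freeLieRange_of_forall {x : NCSeries α}
    (h : ∀ f : NCSeries α →ₗ[ℂ] ℂ, (∀ y ∈ freeLieRange α, f y = 0) → f x = 0) :
    x ∈ freeLieRange α := by
  by_contra hx
  obtain ⟨f, hf, hle⟩ := Submodule.exists_le_ker_of_notMem
    (p := (freeLieRange α).toSubmodule) (v := x) hx
  exact hf (h f fun y hy => hle hy)

/-- The flow of a Lie series preserves the completed free Lie algebra, also from an initial value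
that is only a limit: in each degree the equation is a plain integration. -/
theorem mem_freeLieCompletion_of_flow [Fintype α] {𝕜 : Type*} [RCLike 𝕜]
    [NormedAlgebra 𝕜 ℂ] {D : Set 𝕜} (hD : IsOpen D) (hD' : IsPreconnected D)
    {Y ω ν : 𝕜 → NCSeries α}
    (hω : ∀ t ∈ D, ω t ∈ freeLieCompletion α) (hν : ∀ t ∈ D, ν t ∈ freeLieCompletion α)
    (hY : ∀ t ∈ D, HasCoeffDerivAt Y (ω t * Y t - Y t * ω t + ν t) t) {l : Filter 𝕜} [l.NeBot]
    (hl : ∀ᶠ t in l, t ∈ D) {y₀ : NCSeries α} (h₀ : y₀ ∈ freeLieCompletion α)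
    (hlim : TendstoCoeff Y l y₀) {t : 𝕜} (ht : t ∈ D) : Y t ∈ freeLieCompletion α := by
  intro n
  induction n using Nat.strong_induction_on generalizing t with
  | _ n ih =>
    refine mem_freeLieRange_of_forall fun φ hφ => ?_
    obtain ⟨c, hc⟩ := exists_linearForm_homogeneousPart n φ
    have hder : ∀ u ∈ D, HasDerivAt (fun u => φ (homogeneousPart n (Y u))) 0 u := by
      intro u hu
      have h1 : homogeneousPart n (ω u * Y u - Y u * ω u + ν u) ∈ freeLieRange α := by
        rw [homogeneousPart_add]
        exact add_mem (homogeneousPart_commutator_mem (hω u hu) fun m hm => ih m hm hu)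
          (hν u hu n)
      rw [← hφ _ h1]
      simp only [hc]
      exact HasDerivAt.fun_sum fun v _ => (hY u hu _).mul_const _
    obtain ⟨a, ha⟩ := hD.exists_is_const_of_deriv_eq_zero hD'
      (f := fun u => φ (homogeneousPart n (Y u)))
      (fun u hu => (hder u hu).differentiableAt.differentiableWithinAt)
      (fun u hu => (hder u hu).deriv)
    have h2 : Tendsto (fun u => φ (homogeneousPart n (Y u))) l
        (𝓝 (φ (homogeneousPart n y₀))) := by
      simp only [hc]
      exact tendsto_finsetSum _ fun v _ => (hlim _).mul_const _
    rw [hφ _ (h₀ n)] at h2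
    exact (ha t ht).trans (tendsto_nhds_unique
      (tendsto_const_nhds.congr' (hl.mono fun u hu => (ha u hu).symm)) h2)

/-! ### The exponential group of the completed free Lie algebra -/

/-- The logarithmic derivative of `g` with respect to the Euler derivation. -/
def logEuler (g : NCSeries α) : NCSeries α := euler g * Ring.inverse g

theorem logEuler_one : logEuler (1 : NCSeries α) = 0 := by
  rw [logEuler, euler_one, zero_mul]

theorem logEuler_mul {g h : NCSeries α} (hg : coeff g [] = 1) (hh : coeff h [] = 1) :
    logEuler (g * h) = logEuler g + g * logEuler h * Ring.inverse g := by
  rw [logEuler, logEuler, logEuler, euler_mul, inverse_mul_rev hg hh, add_mul]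
  congr 1
  · rw [mul_assoc, ← mul_assoc h, mul_inverse hh, one_mul]
  · simp only [mul_assoc]

/-- Along `∂H = Ω H`, the logarithmic derivative `Λ` satisfies `∂Λ = [Ω, Λ] + E(Ω)`. -/
theorem hasCoeffDerivAt_logEuler {𝕜 : Type*} [NontriviallyNormedField 𝕜] [NormedAlgebra 𝕜 ℂ]
    {F : 𝕜 → NCSeries α} {ω : NCSeries α} {x : 𝕜} (h1 : ∀ t, coeff (F t) [] = 1)
    (hF : HasCoeffDerivAt F (ω * F x) x) :
    HasCoeffDerivAt (fun t => logEuler (F t))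
      (ω * logEuler (F x) - logEuler (F x) * ω + euler ω) x := by
  refine (hF.euler.mul (hF.inverse_of_flow h1)).congr_deriv ?_
  rw [euler_mul, add_mul, mul_assoc (euler ω), mul_inverse (h1 x), mul_one, logEuler, mul_neg]
  noncomm_ring

/-- Along `t ↦ exp (t m)` the logarithmic derivative follows the flow of `m`, from `0`. -/
theorem logEuler_exp_mem [Fintype α] {m : NCSeries α} (hm : m ∈ freeLieCompletion α) :
    logEuler (exp m) ∈ freeLieCompletion α := by
  have hm0 := coeff_nil_of_mem_freeLieCompletion hm
  have h := mem_freeLieCompletion_of_flow (𝕜 := ℂ) isOpen_univ isPreconnected_univ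
    (Y := fun t => logEuler (exp (t • m))) (ω := fun _ => m) (ν := fun _ => euler m)
    (fun _ _ => hm) (fun _ _ => euler_mem_freeLieCompletion hm)
    (fun t _ => hasCoeffDerivAt_logEuler (fun _ => coeff_exp_nil _) (hasCoeffDerivAt_exp hm0 t))
    (l := pure 0) (by simp) zero_mem_freeLieCompletion
    (fun w => by
      have : logEuler (exp ((0 : ℂ) • m)) = 0 := by rw [zero_smul, exp_zero, logEuler_one]
      simpa only [this] using
        tendsto_pure_nhds (fun t : ℂ => coeff (logEuler (exp (t • m))) w) 0)
    (Set.mem_univ 1)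
  simpa using h

theorem exp_conj_mem [Fintype α] {m y : NCSeries α} (hm : m ∈ freeLieCompletion α)
    (hy : y ∈ freeLieCompletion α) :
    exp m * y * Ring.inverse (exp m) ∈ freeLieCompletion α := by
  have hm0 := coeff_nil_of_mem_freeLieCompletion hm
  have h := mem_freeLieCompletion_of_flow (𝕜 := ℂ) isOpen_univ isPreconnected_univ
    (Y := fun t => exp (t • m) * y * Ring.inverse (exp (t • m))) (ω := fun _ => m)
    (ν := fun _ => 0)
    (fun _ _ => hm) (fun _ _ => zero_mem_freeLieCompletion)
    (fun t _ => (((hasCoeffDerivAt_exp hm0 t).mul_const y).mul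
      ((hasCoeffDerivAt_exp hm0 t).inverse_of_flow fun _ => coeff_exp_nil _)).congr_deriv
        (by noncomm_ring))
    (l := pure 0) (by simp) hy
    (fun w => by
      have : exp ((0 : ℂ) • m) * y * Ring.inverse (exp ((0 : ℂ) • m)) = y := by
        rw [zero_smul, exp_zero, Ring.inverse_one, one_mul, mul_one]
      simpa only [this] using tendsto_pure_nhds
        (fun t : ℂ => coeff (exp (t • m) * y * Ring.inverse (exp (t • m))) w) 0)
    (Set.mem_univ 1)
  simpa using h

/-- The successive approximations of the logarithm of `g`: the step `n` corrects the component
of degree `n`. -/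
def logApprox (g : NCSeries α) : ℕ → NCSeries α
  | 0 => 0
  | n + 1 => logApprox g n + homogeneousPart (n + 1) (g - exp (logApprox g n))

theorem coeff_logApprox_nil (g : NCSeries α) (n : ℕ) : coeff (logApprox g n) [] = 0 := by
  induction n with
  | zero => rfl
  | succ n ih => rw [logApprox, coeff_add, ih, coeff_homogeneousPart]; simp

theorem orderGE_sub_exp_logApprox {g : NCSeries α} (hg : coeff g [] = 1) (n : ℕ) :
    OrderGE (n + 1) (g - exp (logApprox g n)) := by
  induction n with
  | zero =>
    refine OrderGE.of_coeff_nil ?_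
    rw [coeff_sub, hg, coeff_exp_nil, sub_self]
  | succ n ih =>
    have h := orderGE_exp_add_sub (coeff_logApprox_nil g n)
      (orderGE_homogeneousPart (n + 1) (g - exp (logApprox g n)))
    rw [logApprox]
    intro w hw
    have hw' := h w hw
    rw [coeff_sub, coeff_add, coeff_homogeneousPart, sub_eq_zero] at hw'
    rw [coeff_sub, hw']
    rcases eq_or_ne w.length (n + 1) with h1 | h1
    · rw [if_pos h1, coeff_sub]
      ring
    · rw [if_neg h1, add_zero, ← coeff_sub]
      exact ih w (by omega)

theorem logApprox_mem [Fintype α] {g : NCSeries α} (hg : coeff g [] = 1)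
    (h : logEuler g ∈ freeLieCompletion α) (n : ℕ) : logApprox g n ∈ freeLieCompletion α := by
  induction n with
  | zero => exact zero_mem_freeLieCompletion
  | succ n ih =>
    have hm := coeff_logApprox_nil g n
    have hord := orderGE_sub_exp_logApprox hg n
    rw [logApprox]
    set m := logApprox g n with hmdef
    have ih' := neg_mem_freeLieCompletion ih
    refine add_mem_freeLieCompletion ih ?_
    -- the quotient `q` is `1 + d` with `d` of order `n + 1`, and `d` and `logEuler q` have
    -- leading terms that differ by the factor `n + 1`
    set q := exp (-m) * g with hq
    have hq1 : coeff q [] = 1 := coeff_mul_nil_eq_one (coeff_exp_nil _) hg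
    have hqL : logEuler q ∈ freeLieCompletion α := by
      rw [hq, logEuler_mul (coeff_exp_nil _) hg]
      exact add_mem_freeLieCompletion (logEuler_exp_mem ih') (exp_conj_mem ih' h)
    have hqd : q = 1 + exp (-m) * (g - exp m) := by
      rw [mul_sub, exp_neg_mul_exp hm, hq]
      abel
    have hE : euler q = euler (exp (-m) * (g - exp m)) := by
      rw [hqd, map_add, euler_one, zero_add]
    have hEord : OrderGE (n + 1) (euler q) := fun w hw => by
      rw [hE, coeff_euler, ((OrderGE.any _).mul hord) w (by omega), mul_zero]
    have hhom : homogeneousPart (n + 1) (logEuler q) =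
        ((n + 1 : ℕ) : ℂ) • homogeneousPart (n + 1) (g - exp m) := by
      ext w
      rw [coeff_smul, coeff_homogeneousPart, coeff_homogeneousPart]
      split_ifs with hw
      · rw [logEuler, hEord.coeff_mul_right _ hw.le, coeff_inverse_nil hq1, mul_one, hE,
          coeff_euler, hord.coeff_mul_left _ hw.le, coeff_exp_nil, one_mul, hw]
      · rw [mul_zero]
    have hmem : homogeneousPart (n + 1) (g - exp m) ∈ freeLieRange α := by
      have h1 := (freeLieRange α).smul_mem (((n + 1 : ℕ) : ℂ)⁻¹) (hqL (n + 1))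
      rwa [hhom, smul_smul, inv_mul_cancel₀ (by exact_mod_cast n.succ_ne_zero), one_smul] at h1
    intro k
    rw [homogeneousPart_homogeneousPart]
    split_ifs
    · exact hmem
    · exact zero_mem _

/-- A unipotent series belongs to the exponential group as soon as its logarithmic derivative
with respect to the Euler derivation is a Lie series. -/
theorem mem_expFreeLie_of_logEuler [Fintype α] {g : NCSeries α} (hg : coeff g [] = 1)
    (h : logEuler g ∈ freeLieCompletion α) : g ∈ expFreeLie α := by
  have hstep : ∀ n k, OrderGE (n + 1) (logApprox g (n + k) - logApprox g n) := by
    intro n k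
    induction k with
    | zero => simpa using OrderGE.zero
    | succ k ih =>
      rw [← add_assoc, logApprox, add_sub_right_comm]
      exact ih.add ((orderGE_homogeneousPart _ _).mono (by omega))
  let x : NCSeries α := fun w => coeff (logApprox g w.length) w
  have hx : ∀ n, OrderGE (n + 1) (x - logApprox g n) := by
    intro n w hw
    have h1 := hstep w.length (n - w.length) w (Nat.lt_succ_self _)
    rw [Nat.add_sub_cancel' (by omega), coeff_sub, sub_eq_zero] at h1
    rw [coeff_sub, h1]
    exact sub_self _
  refine ⟨x, fun n => ?_, ?_⟩
  · have h1 : homogeneousPart n x = homogeneousPart n (logApprox g n) := by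
      ext w
      rw [coeff_homogeneousPart, coeff_homogeneousPart]
      split_ifs with hw
      · have := hx n w (by omega)
        rwa [coeff_sub, sub_eq_zero] at this
      · rfl
    rw [h1]
    exact logApprox_mem hg h n n
  · refine eq_of_forall_orderGE_sub fun n => ?_
    have h1 := orderGE_exp_add_sub (coeff_logApprox_nil g n) (hx n)
    rw [add_sub_cancel] at h1
    have e : exp x - g = (exp x - (exp (logApprox g n) + (x - logApprox g n)))
        - (g - exp (logApprox g n)) + (x - logApprox g n) := by abel
    rw [e]
    exact (((h1.mono (by omega)).sub (orderGE_sub_exp_logApprox hg n)).add (hx n)).mono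
      (by omega)

theorem mem_expFreeLie_iff [Fintype α] {g : NCSeries α} :
    g ∈ expFreeLie α ↔ coeff g [] = 1 ∧ logEuler g ∈ freeLieCompletion α := by
  constructor
  · rintro ⟨x, hx, rfl⟩
    exact ⟨coeff_exp_nil x, logEuler_exp_mem hx⟩
  · rintro ⟨hg, h⟩
    exact mem_expFreeLie_of_logEuler hg h

theorem mul_mem_expFreeLie [Fintype α] {g h : NCSeries α} (hg : g ∈ expFreeLie α)
    (hh : h ∈ expFreeLie α) :
    g * h ∈ expFreeLie α := by
  obtain ⟨x, hx, rfl⟩ := hg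
  rw [mem_expFreeLie_iff] at hh ⊢
  refine ⟨coeff_mul_nil_eq_one (coeff_exp_nil x) hh.1, ?_⟩
  rw [logEuler_mul (coeff_exp_nil x) hh.1]
  exact add_mem_freeLieCompletion (logEuler_exp_mem hx) (exp_conj_mem hx hh.2)

theorem inverse_mem_expFreeLie {g : NCSeries α} (hg : g ∈ expFreeLie α) :
    Ring.inverse g ∈ expFreeLie α := by
  obtain ⟨x, hx, rfl⟩ := hg
  exact ⟨-x, neg_mem_freeLieCompletion hx,
    (inverse_exp (coeff_nil_of_mem_freeLieCompletion hx)).symm⟩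

/-- A solution `H` of `∂H = Ω H`, for Lie series `Ω`, takes values in the exponential group if its
regularization `P = H exp (φ x)`, for some Lie element `x` of degree `1`, tends to `1`. Indeed
`P x P⁻¹` follows the flow of `Ω` in the Lie algebra and tends to `x`, and the logarithmic
derivative of `P` then follows the flow of `Ω` with a source term in the Lie algebra, and tends to
`0`. -/
theorem mem_expFreeLie_of_flow_of_tendsto [Fintype α] {D : Set ℝ} (hD : IsOpen D)
    (hD' : IsPreconnected D) {H ω : ℝ → NCSeries α}
    (hω : ∀ t ∈ D, ω t ∈ freeLieCompletion α) (h1 : ∀ t, coeff (H t) [] = 1)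
    (hH : ∀ t ∈ D, HasCoeffDerivAt H (ω t * H t) t) {l : Filter ℝ} [l.NeBot]
    (hl : ∀ᶠ t in l, t ∈ D) {φ φ' : ℝ → ℂ} (hφ : ∀ t ∈ D, HasDerivAt φ (φ' t) t)
    {x : NCSeries α} (hx : x ∈ freeLieCompletion α) (hx1 : euler x = x)
    (hlim : TendstoCoeff (fun t => H t * exp (φ t • x)) l 1) {t : ℝ} (ht : t ∈ D) :
    H t ∈ expFreeLie α := by
  have hx0 := coeff_nil_of_mem_freeLieCompletion hx
  set P : ℝ → NCSeries α := fun t => H t * exp (φ t • x) with hP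
  have hP1 : ∀ t, coeff (P t) [] = 1 := fun t => coeff_mul_nil_eq_one (h1 t) (coeff_exp_nil _)
  have hPd : ∀ t ∈ D, HasCoeffDerivAt P (ω t * P t + φ' t • (P t * x)) t := by
    intro t ht
    have he : HasCoeffDerivAt (fun t => exp (φ t • x)) (φ' t • (x * exp (φ t • x))) t :=
      fun w => HasDerivAt.scomp t (hasCoeffDerivAt_exp hx0 (φ t) w) (hφ t ht)
    refine ((hH t ht).mul he).congr_deriv ?_
    rw [(commute_exp_smul hx0 (φ t)).eq, hP, mul_smul_comm, mul_assoc, mul_assoc]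
  have hQd : ∀ t ∈ D, HasCoeffDerivAt (fun t => Ring.inverse (P t))
      (-(Ring.inverse (P t) * ω t) - φ' t • (x * Ring.inverse (P t))) t := by
    intro t ht
    refine (HasCoeffDerivAt.inverse hP1 (hPd t ht)).congr_deriv ?_
    rw [mul_add, add_mul, mul_smul_comm, smul_mul_assoc, ← mul_assoc _ (P t) x,
      inverse_mul (hP1 t), one_mul, mul_assoc, mul_assoc, mul_inverse (hP1 t), mul_one, neg_add',
      sub_eq_add_neg]
  have hlimQ : TendstoCoeff (fun t => Ring.inverse (P t)) l 1 := by
    simpa only [Ring.inverse_one] using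
      TendstoCoeff.inverse (Eventually.of_forall hP1) coeff_one_nil hlim
  have hκ : ∀ t ∈ D, P t * x * Ring.inverse (P t) ∈ freeLieCompletion α := by
    intro t ht
    refine mem_freeLieCompletion_of_flow hD hD'
      (Y := fun t => P t * x * Ring.inverse (P t)) (ν := fun _ => 0) hω
      (fun _ _ => zero_mem_freeLieCompletion) (fun u hu => ?_) hl hx ?_ ht
    · refine (((hPd u hu).mul_const x).mul (hQd u hu)).congr_deriv ?_
      simp only [add_mul, mul_sub, mul_neg, smul_mul_assoc, mul_smul_comm, mul_assoc, add_zero]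
      abel
    · simpa only [one_mul, mul_one] using (hlim.mul (TendstoCoeff.const x)).mul hlimQ
  have hPmem : P t ∈ expFreeLie α := by
    refine mem_expFreeLie_of_logEuler (hP1 t) ?_
    refine mem_freeLieCompletion_of_flow hD hD' (Y := fun t => logEuler (P t))
      (ν := fun t => euler (ω t) + φ' t • (P t * x * Ring.inverse (P t))) hω
      (fun u hu => add_mem_freeLieCompletion (euler_mem_freeLieCompletion (hω u hu))
        (smul_mem_freeLieCompletion _ (hκ u hu))) (fun u hu => ?_) hl
      zero_mem_freeLieCompletion ?_ ht
    · refine ((hPd u hu).euler.mul (hQd u hu)).congr_deriv ?_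
      have e : euler (ω u) * P u * Ring.inverse (P u) = euler (ω u) := by
        rw [mul_assoc, mul_inverse (hP1 u), mul_one]
      simp only [map_add, map_smul, euler_mul, hx1, add_mul, e, logEuler, smul_mul_assoc,
        smul_add, mul_sub, mul_neg, mul_smul_comm, mul_assoc]
      abel
    · simpa only [euler_one, zero_mul, logEuler] using hlim.euler.mul hlimQ
  have e : H t = P t * exp (-(φ t • x)) := by
    rw [hP, mul_assoc, exp_mul_exp_neg (coeff_smul_nil hx0 _), mul_one]
  rw [e]
  exact mul_mem_expFreeLie hPmem
    ⟨_, neg_mem_freeLieCompletion (smul_mem_freeLieCompletion _ hx), rfl⟩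

end Lie

/-! ### Linear substitutions -/

section Subst

variable {α : Type} {φ : α → NCSeries α}

theorem coeff_X (a : α) (w : List α) [Decidable (w = [a])] :
    coeff (X a) w = if w = [a] then 1 else 0 := by
  by_cases h : w = [a]
  · rw [if_pos h]
    exact if_pos h
  · rw [if_neg h]
    exact if_neg h

theorem coeff_X_cons [DecidableEq α] (a c : α) (w : List α) :
    coeff (X a) (c :: w) = if c = a then coeff 1 w else 0 := by
  rw [coeff_X, coeff_one]
  by_cases h : c = a <;> simp [h]

/-- The substitution `φ` sends the letters to linear combinations of letters. -/
def IsLinearSubst (φ : α → NCSeries α) : Prop := ∀ a w, w.length ≠ 1 → coeff (φ a) w = 0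

theorem IsLinearSubst.coeff_mul_cons (hφ : IsLinearSubst φ) (c a : α) (f : NCSeries α)
    (w : List α) : coeff (φ c * f) (a :: w) = coeff (φ c) [a] * coeff f w := by
  have h : tail a (φ c) = coeff (φ c) [a] • 1 := by
    ext u
    rw [coeff_tail, coeff_smul, coeff_one]
    cases u with
    | nil => simp
    | cons d u => rw [hφ c _ (by simp)]; simp
  rw [NCSeries.coeff_mul_cons, hφ c [] (by simp), zero_mul, zero_add, h, smul_mul_assoc, one_mul,
    coeff_smul]

variable [Fintype α]

theorem coeff_subst (φ : α → NCSeries α) (f : NCSeries α) (w : List α) :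
    coeff (subst φ f) w = ∑ n ∈ Finset.range (w.length + 1), ∑ v : Fin n → α,
      coeff f (List.ofFn v) * coeff (List.ofFn fun j => φ (v j)).prod w := rfl

/-- The substitution `subst φ`, as a linear map. -/
def substLinear (φ : α → NCSeries α) : NCSeries α →ₗ[ℂ] NCSeries α where
  toFun := subst φ
  map_add' f g := by
    ext w
    simp only [coeff_subst, coeff_add, add_mul, Finset.sum_add_distrib]
  map_smul' c f := by
    ext w
    simp only [coeff_subst, coeff_smul, mul_assoc, Finset.mul_sum, RingHom.id_apply]

theorem substLinear_apply (f : NCSeries α) : substLinear φ f = subst φ f := rfl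

theorem coeff_subst_nil (f : NCSeries α) : coeff (subst φ f) [] = coeff f [] := by
  simp [coeff_subst]

theorem TendstoCoeff.subst {ι : Type*} {l : Filter ι} {F : ι → NCSeries α} {f : NCSeries α}
    (φ : α → NCSeries α) (h : TendstoCoeff F l f) :
    TendstoCoeff (fun t => subst φ (F t)) l (subst φ f) := fun w => by
  simp only [coeff_subst]
  exact tendsto_finsetSum _ fun n _ => tendsto_finsetSum _ fun v _ => (h _).mul_const _

theorem HasCoeffDerivAt.subst {𝕜 : Type*} [NontriviallyNormedField 𝕜] [NormedAlgebra 𝕜 ℂ]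
    {F : 𝕜 → NCSeries α} {f' : NCSeries α} {x : 𝕜} (φ : α → NCSeries α)
    (h : HasCoeffDerivAt F f' x) :
    HasCoeffDerivAt (fun t => subst φ (F t)) (subst φ f') x := fun w => by
  simp only [coeff_subst]
  exact HasDerivAt.fun_sum fun n _ => HasDerivAt.fun_sum fun v _ => (h _).mul_const _

/-- The recursion on words that determines a linear substitution. -/
theorem IsLinearSubst.tail_subst (hφ : IsLinearSubst φ) (a : α) (f : NCSeries α) :
    tail a (subst φ f) = ∑ c, coeff (φ c) [a] • subst φ (tail c f) := by
  ext w
  rw [coeff_tail, coeff_subst, List.length_cons, Finset.sum_range_succ', coeff_sum]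
  have h0 : ∑ v : Fin 0 → α,
      coeff f (List.ofFn v) * coeff (List.ofFn fun j => φ (v j)).prod (a :: w) = 0 := by
    simp [coeff_one]
  rw [h0, add_zero]
  simp only [coeff_smul, coeff_subst, Finset.mul_sum]
  rw [Finset.sum_comm]
  refine Finset.sum_congr rfl fun n _ => ?_
  rw [← (Fin.consEquiv fun _ : Fin (n + 1) => α).sum_comp, Fintype.sum_prod_type]
  refine Finset.sum_congr rfl fun c _ => Finset.sum_congr rfl fun v _ => ?_
  simp only [Fin.consEquiv_apply, List.ofFn_succ, Fin.cons_zero, Fin.cons_succ, List.prod_cons,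
    hφ.coeff_mul_cons, coeff_tail]
  ring

theorem subst_one : subst φ (1 : NCSeries α) = 1 := by
  ext w
  rw [coeff_subst, Finset.sum_range_succ']
  have : ∀ n, ∀ v : Fin (n + 1) → α, coeff (1 : NCSeries α) (List.ofFn v) = 0 := by
    intro n v
    rw [coeff_one, List.length_ofFn, if_neg n.succ_ne_zero]
  simp only [this, zero_mul, Finset.sum_const_zero, zero_add]
  simp

theorem IsLinearSubst.subst_mul (hφ : IsLinearSubst φ) (f g : NCSeries α) :
    subst φ (f * g) = subst φ f * subst φ g := by
  ext w
  induction w generalizing f with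
  | nil => rw [coeff_mul_nil, coeff_subst_nil, coeff_subst_nil, coeff_subst_nil, coeff_mul_nil]
  | cons a w ih =>
    have ih' : ∀ c, coeff (subst φ (tail c (f * g))) w =
        coeff f [] * coeff (subst φ (tail c g)) w +
          coeff (subst φ (tail c f) * subst φ g) w := by
      intro c
      rw [tail_mul, ← substLinear_apply, map_add, map_smul, coeff_add, coeff_smul,
        substLinear_apply, substLinear_apply, ih]
    rw [← coeff_tail, ← coeff_tail, tail_mul, hφ.tail_subst, hφ.tail_subst, hφ.tail_subst,
      coeff_subst_nil, coeff_add, coeff_smul, Finset.sum_mul]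
    simp only [coeff_sum, coeff_smul, ih', smul_mul_assoc, mul_add, Finset.sum_add_distrib,
      Finset.mul_sum]
    congr 1
    exact Finset.sum_congr rfl fun c _ => by ring

/-- A linear substitution, as an algebra morphism. -/
def substAlgHom (hφ : IsLinearSubst φ) : NCSeries α →ₐ[ℂ] NCSeries α :=
  AlgHom.ofLinearMap (substLinear φ) subst_one hφ.subst_mul

theorem substAlgHom_apply (hφ : IsLinearSubst φ) (f : NCSeries α) :
    substAlgHom hφ f = subst φ f := rfl

theorem OrderGE.subst (hφ : IsLinearSubst φ) {n : ℕ} {f : NCSeries α} (hf : OrderGE n f) :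
    OrderGE n (subst φ f) := by
  intro w
  induction w generalizing n f with
  | nil => exact fun hw => by rw [coeff_subst_nil, hf [] hw]
  | cons a w ih =>
    intro hw
    rw [← coeff_tail, hφ.tail_subst, coeff_sum]
    refine Finset.sum_eq_zero fun c _ => ?_
    have : OrderGE (n - 1) (tail c f) := fun u hu => hf (c :: u) (by
      rw [List.length_cons]
      omega)
    rw [coeff_smul, ih this (by rw [List.length_cons] at hw; omega), mul_zero]

theorem IsLinearSubst.subst_exp (hφ : IsLinearSubst φ) {x : NCSeries α} (hx : coeff x [] = 0) :
    subst φ (exp x) = exp (subst φ x) := by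
  have hx' : coeff (subst φ x) [] = 0 := by rw [coeff_subst_nil, hx]
  refine eq_of_forall_orderGE_sub fun n => ?_
  have h1 := OrderGE.subst hφ
    (orderGE_evalSeries_sub (fun k => (k.factorial : ℂ)⁻¹) hx n)
  have h2 := orderGE_evalSeries_sub (fun k => (k.factorial : ℂ)⁻¹) hx' n
  rw [← substAlgHom_apply hφ, map_sub, map_sum] at h1
  simp only [map_smul, map_pow, substAlgHom_apply] at h1
  have h := h1.sub h2
  rw [sub_sub_sub_cancel_right] at h
  exact h.mono n.le_succ

theorem IsLinearSubst.subst_X (hφ : IsLinearSubst φ) (a : α) : subst φ (X a) = φ a := by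
  classical
  ext w
  cases w with
  | nil => rw [coeff_subst_nil, coeff_X_nil, hφ a [] (by simp)]
  | cons c w =>
    have h : ∀ d, tail d (X a) = if d = a then (1 : NCSeries α) else 0 := by
      intro d
      ext u
      rw [coeff_tail, coeff_X_cons]
      split_ifs <;> rfl
    rw [← coeff_tail, hφ.tail_subst, Finset.sum_eq_single_of_mem a (Finset.mem_univ a), h,
      if_pos rfl, subst_one, coeff_smul, coeff_one]
    · cases w with
      | nil => simp
      | cons e w => simp [hφ a (c :: e :: w) (by simp)]
    · intro d _ hd
      rw [h, if_neg hd, ← substLinear_apply, map_zero, smul_zero]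

end Subst

end NCSeries

namespace KZ4

open NCSeries

/-! ### The automorphism of order three -/

theorem A_coeff_nil : coeff A [] = 0 := coeff_X_nil _

theorem b_coeff_nil (k : Fin 4) : coeff (b k) [] = 0 := coeff_X_nil _

theorem isLinearSubst_sGen : IsLinearSubst sGen := by
  have hX : ∀ (a : Gen) (w : List Gen), w.length ≠ 1 → coeff (X a) w = 0 := by
    intro a w hw
    rw [coeff_X, if_neg]
    rintro rfl
    exact hw rfl
  have hC : ∀ w : List Gen, w.length ≠ 1 → coeff C w = 0 := by
    intro w hw
    rw [C, coeff_sub, coeff_neg, coeff_sum, A, hX _ w hw,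
      Finset.sum_eq_zero (f := fun k => coeff (b k) w) fun k _ => hX (some k) w hw, neg_zero,
      sub_zero]
  intro a w hw
  match a with
  | none => exact hX _ w hw
  | some 0 => exact hX _ w hw
  | some 1 => exact hX _ w hw
  | some 2 => exact hX _ w hw
  | some 3 => exact hC w hw

theorem s_mul (f g : NCSeries Gen) : s (f * g) = s f * s g := isLinearSubst_sGen.subst_mul f g

theorem s_A : s A = b 0 := isLinearSubst_sGen.subst_X none

theorem s_b (k : Fin 4) : s (b k) = sGen (some k) := isLinearSubst_sGen.subst_X (some k)

theorem s_cpow (a : ℂ) {x : NCSeries Gen} (hx : coeff x [] = 0) :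
    s (cpow a x) = cpow a (s x) := by
  rw [cpow, s, isLinearSubst_sGen.subst_exp (coeff_smul_nil hx _), ← substLinear_apply, map_smul]
  rfl

theorem coeff_s_nil (f : NCSeries Gen) : coeff (s f) [] = coeff f [] := coeff_subst_nil f

theorem coeff_s_cons (f : NCSeries Gen) (a : Gen) (w : List Gen) :
    coeff (s f) (a :: w) = ∑ c, coeff (sGen c) [a] * coeff (s (tail c f)) w := by
  rw [← coeff_tail, s, isLinearSubst_sGen.tail_subst, coeff_sum]
  rfl

theorem s_tail_s (f : NCSeries Gen) (a : Gen) :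
    s (tail a (s f)) = ∑ c, coeff (sGen c) [a] • s (s (tail c f)) := by
  conv_lhs => rw [s, s, isLinearSubst_sGen.tail_subst, ← substLinear_apply, map_sum]
  simp only [map_smul]
  rfl

theorem s_s_tail_s (f : NCSeries Gen) (a : Gen) :
    s (s (tail a (s f))) = ∑ c, coeff (sGen c) [a] • s (s (s (tail c f))) := by
  rw [s_tail_s]
  conv_lhs => rw [s, ← substLinear_apply, map_sum]
  simp only [map_smul]
  rfl

/-- The matrix of `sGen` has order `3`. -/
theorem sGen_matrix_pow_three (u : Gen → ℂ) (a : Gen) :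
    ∑ c, coeff (sGen c) [a] * ∑ d, coeff (sGen d) [c] * ∑ e, coeff (sGen e) [d] * u e = u a := by
  have h : ∀ (v : Gen → ℂ) (a : Gen), ∑ c, coeff (sGen c) [a] * v c =
      match a with
      | none => v (some 1) - v (some 3)
      | some 0 => v none - v (some 3)
      | some 1 => v (some 0) - v (some 3)
      | some 2 => - v (some 3)
      | some 3 => v (some 2) - v (some 3) := by
    intro v a
    match a with
    | none | some 0 | some 1 | some 2 | some 3 =>
      simp [Fintype.sum_option, Fin.sum_univ_four, sGen, A, b, C, coeff_X]
      try ring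
  simp only [h]
  match a with
  | none | some 0 | some 1 | some 2 | some 3 => ring

theorem s_s_s (f : NCSeries Gen) : s (s (s f)) = f := by
  ext w
  induction w generalizing f with
  | nil => simp only [coeff_s_nil]
  | cons a w ih =>
    rw [coeff_s_cons]
    simp only [s_tail_s (s f), coeff_sum, coeff_smul, s_s_tail_s, ih]
    exact sGen_matrix_pow_three (fun e => coeff f (e :: w)) a

end KZ4

namespace NCSeries

theorem coeff_X_mul_cons {α : Type} [DecidableEq α] (c a : α) (f : NCSeries α) (w : List α) :
    coeff (X c * f) (a :: w) = if a = c then coeff f w else 0 := by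
  have h : IsLinearSubst (X : α → NCSeries α) := fun d u hu => by
    classical
    rw [coeff_X, if_neg]
    rintro rfl
    exact hu rfl
  rw [h.coeff_mul_cons, coeff_X]
  by_cases hac : a = c <;> simp [hac]

theorem coeff_mul_X {α : Type} [DecidableEq α] (c : α) (f : NCSeries α) (w : List α) :
    coeff (f * X c) w = if w.getLast? = some c then coeff f w.dropLast else 0 := by
  induction w generalizing f with
  | nil => simp [coeff_mul_nil, coeff_X_nil]
  | cons a w ih =>
    rw [coeff_mul_cons, ih, coeff_X_cons]
    cases w with
    | nil => by_cases h : a = c <;> simp [h]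
    | cons d w => simp [coeff_one, coeff_tail, List.getLast?_cons_cons]

end NCSeries

namespace KZ4

open NCSeries

/-! ### The normalized solution at the origin -/

/-- The part of the connection that is regular at `0`. -/
def regularPart (z : ℂ) : NCSeries Gen := ∑ k : Fin 4, (z - Complex.I ^ (k : ℕ))⁻¹ • b k

theorem connection_eq (z : ℂ) : connection z = z⁻¹ • A + regularPart z := rfl

open Classical in
/-- A primitive of `f` on the unit disc that vanishes at `0`, and the junk value `0` if there is
none. -/
def discPrimitive (f : ℂ → ℂ) : ℂ → ℂ :=
  if h : ∃ F : ℂ → ℂ, F 0 = 0 ∧ ∀ z ∈ Metric.ball (0 : ℂ) 1, HasDerivAt F (f z) z then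
    h.choose else 0

theorem discPrimitive_spec {f : ℂ → ℂ} (hf : DifferentiableOn ℂ f (Metric.ball 0 1)) :
    discPrimitive f 0 = 0 ∧
      ∀ z ∈ Metric.ball (0 : ℂ) 1, HasDerivAt (discPrimitive f) (f z) z := by
  have h : ∃ F : ℂ → ℂ, F 0 = 0 ∧ ∀ z ∈ Metric.ball (0 : ℂ) 1, HasDerivAt F (f z) z :=
    hf.isExactOn_ball.with_val_at 0 0
  rw [discPrimitive, dif_pos h]
  exact h.choose_spec

/-- The coefficients of the solution `P` of `P' = [A, P] / z + R P` on the unit disc with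
`P(0) = 1`, where `R` is the part of the connection that is regular at `0`. The coefficient of a
word is obtained from those of shorter words by integration; as the coefficients of `[A, P]`
vanish at `0`, the quotient by `z` is regular, and `dslope` gives its value at `0`. -/
def regularCoeff : List Gen → ℂ → ℂ
  | [] => fun _ => 1
  | a :: w => discPrimitive fun z =>
      dslope (fun u => (if a = none then regularCoeff w u else 0) -
        if (a :: w).getLast? = some none then regularCoeff (a :: w).dropLast u else 0) 0 z +
      ∑ k : Fin 4, (z - Complex.I ^ (k : ℕ))⁻¹ * if a = some k then regularCoeff w z else 0
  termination_by w => w.length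

/-- The solution `P` of `P' = [A, P] / z + R P` on the unit disc with `P(0) = 1`. -/
def regularSolution (z : ℂ) : NCSeries Gen := fun w => regularCoeff w z

theorem coeff_regularSolution (z : ℂ) (w : List Gen) :
    coeff (regularSolution z) w = regularCoeff w z := rfl

theorem regularCoeff_cons (a : Gen) (w : List Gen) :
    regularCoeff (a :: w) = discPrimitive fun z =>
      dslope (fun u => coeff (A * regularSolution u - regularSolution u * A) (a :: w)) 0 z +
        coeff (regularPart z * regularSolution z) (a :: w) := by
  rw [regularCoeff]
  congr 1
  funext z
  simp only [A, b, regularPart, coeff_sub, coeff_X_mul_cons, coeff_mul_X, Finset.sum_mul,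
    coeff_sum, smul_mul_assoc, coeff_smul, coeff_regularSolution]

theorem coeff_regularSolution_nil (z : ℂ) : coeff (regularSolution z) [] = 1 := by
  rw [coeff_regularSolution, regularCoeff]

theorem sub_I_pow_ne_zero {z : ℂ} (hz : z ∈ Metric.ball (0 : ℂ) 1) (k : ℕ) :
    z - Complex.I ^ k ≠ 0 := by
  intro h
  rw [sub_eq_zero] at h
  rw [mem_ball_zero_iff, h, norm_pow, Complex.norm_I, one_pow] at hz
  exact lt_irrefl _ hz

theorem regularCoeff_spec (w : List Gen) :
    DifferentiableOn ℂ (regularCoeff w) (Metric.ball 0 1) ∧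
      regularCoeff w 0 = coeff (1 : NCSeries Gen) w ∧
      ∀ z ∈ Metric.ball (0 : ℂ) 1, z ≠ 0 → HasDerivAt (regularCoeff w)
        (coeff (z⁻¹ • (A * regularSolution z - regularSolution z * A) +
          regularPart z * regularSolution z) w) z := by
  induction hn : w.length using Nat.strong_induction_on generalizing w with
  | _ n ih =>
    subst hn
    cases w with
    | nil =>
      have h : regularCoeff [] = fun _ => 1 := by rw [regularCoeff]
      rw [h]
      refine ⟨differentiableOn_const _, by rw [coeff_one_nil], fun z _ _ => ?_⟩
      have h0 : coeff (regularPart z) [] = 0 := by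
        simp [regularPart, coeff_sum, b_coeff_nil]
      rw [coeff_add, coeff_smul, coeff_sub, coeff_mul_nil, coeff_mul_nil, coeff_mul_nil,
        A_coeff_nil, h0, zero_mul, mul_zero, sub_zero, mul_zero, add_zero]
      exact hasDerivAt_const _ _
    | cons a w =>
      have hw := ih w.length (by simp) w rfl
      have hd := ih (a :: w).dropLast.length (by simp) _ rfl
      set C := fun u => coeff (A * regularSolution u - regularSolution u * A) (a :: w) with hC
      have hCe : C = fun u => (if a = none then regularCoeff w u else 0) -
          if (a :: w).getLast? = some none then regularCoeff (a :: w).dropLast u else 0 := by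
        funext u
        simp only [hC, A, coeff_sub, coeff_X_mul_cons, coeff_mul_X, coeff_regularSolution]
      have hC0 : C 0 = 0 := by
        rw [hCe]
        simp only [hw.2.1, hd.2.1]
        cases w with
        | nil => simp
        | cons c w => simp [coeff_one]
      have hCd : DifferentiableOn ℂ C (Metric.ball 0 1) := by
        rw [hCe]
        refine DifferentiableOn.fun_sub ?_ ?_
        · split_ifs
          exacts [hw.1, differentiableOn_const _]
        · split_ifs
          exacts [hd.1, differentiableOn_const _]
      have hR : DifferentiableOn ℂ
          (fun z => coeff (regularPart z * regularSolution z) (a :: w)) (Metric.ball 0 1) := by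
        simp only [b, regularPart, coeff_X_mul_cons, Finset.sum_mul, coeff_sum, smul_mul_assoc,
          coeff_smul, coeff_regularSolution]
        refine DifferentiableOn.fun_sum fun k _ => DifferentiableOn.fun_mul ?_ ?_
        · exact DifferentiableOn.fun_inv (differentiableOn_id.sub_const _)
            fun z hz => sub_I_pow_ne_zero hz k
        · split_ifs
          exacts [hw.1, differentiableOn_const _]
      have hball : Metric.ball (0 : ℂ) 1 ∈ 𝓝 0 := Metric.ball_mem_nhds _ one_pos
      obtain ⟨h0, hder⟩ := discPrimitive_spec
        (((Complex.differentiableOn_dslope hball).mpr hCd).fun_add hR)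
      rw [regularCoeff_cons]
      refine ⟨fun z hz => (hder z hz).differentiableAt.differentiableWithinAt, ?_, ?_⟩
      · rw [h0, coeff_one, if_neg (by simp)]
      · intro z hz hz0
        refine (hder z hz).congr_deriv ?_
        rw [dslope_of_ne _ hz0, slope_def_field, hC0, coeff_add, coeff_smul, sub_zero, sub_zero,
          div_eq_inv_mul]

theorem hasCoeffDerivAt_regularSolution {z : ℂ} (hz : z ∈ Metric.ball (0 : ℂ) 1) (hz0 : z ≠ 0) :
    HasCoeffDerivAt regularSolution
      (z⁻¹ • (A * regularSolution z - regularSolution z * A) +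
        regularPart z * regularSolution z) z :=
  fun w => (regularCoeff_spec w).2.2 z hz hz0

theorem tendstoCoeff_regularSolution : TendstoCoeff regularSolution (𝓝 0) 1 := fun w => by
  have h := (regularCoeff_spec w).1.continuousOn.continuousAt
    (Metric.ball_mem_nhds (0 : ℂ) one_pos)
  rw [ContinuousAt, (regularCoeff_spec w).2.1] at h
  exact h

/-- The solution `P(z) z ^ A` on the unit disc cut along the negative axis. -/
def zeroSolution (z : ℂ) : NCSeries Gen := regularSolution z * cpow z A

theorem coeff_zeroSolution_nil (z : ℂ) : coeff (zeroSolution z) [] = 1 :=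
  coeff_mul_nil_eq_one (coeff_regularSolution_nil z) (coeff_exp_nil _)

theorem hasCoeffDerivAt_zeroSolution {z : ℂ} (hz : z ∈ Metric.ball (0 : ℂ) 1)
    (hz' : z ∈ Complex.slitPlane) :
    HasCoeffDerivAt zeroSolution (connection z * zeroSolution z) z := by
  refine ((hasCoeffDerivAt_regularSolution hz (Complex.slitPlane_ne_zero hz')).mul
    ((hasCoeffDerivAt_exp A_coeff_nil (Complex.log z)).comp
      (Complex.hasDerivAt_log hz'))).congr_deriv ?_
  rw [zeroSolution, connection_eq, cpow]
  simp only [add_mul, smul_mul_assoc, mul_smul_comm, sub_mul, smul_sub, mul_assoc]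
  abel

/-! ### The rotation of order three of the configuration of poles -/

/-- The inverse `z ↦ i (1 - z) / (1 + z)` of the rotation `z ↦ (1 + i z) / (1 - i z)`. -/
def rotInv (z : ℂ) : ℂ := Complex.I * (1 - z) / (1 + z)

/-- The right half of the unit disc. -/
def halfDisc : Set ℂ := Metric.ball 0 1 ∩ {z | 0 < z.re}

theorem isOpen_halfDisc : IsOpen halfDisc :=
  Metric.isOpen_ball.inter (isOpen_lt continuous_const Complex.continuous_re)

theorem isPreconnected_halfDisc : IsPreconnected halfDisc :=
  ((convex_ball 0 1).inter (convex_halfSpace_re_gt 0)).isPreconnected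

theorem mem_halfDisc_slitPlane {z : ℂ} (hz : z ∈ halfDisc) : z ∈ Complex.slitPlane :=
  Or.inl hz.2

theorem one_add_ne_zero {z : ℂ} (hz : z ∈ halfDisc) : 1 + z ≠ 0 := by
  intro h
  have h1 := congrArg Complex.re h
  have h2 : 0 < z.re := hz.2
  simp at h1
  linarith

theorem ofReal_mem_halfDisc {t : ℝ} (ht : t ∈ Set.Ioo (0 : ℝ) 1) : (t : ℂ) ∈ halfDisc := by
  refine ⟨?_, ?_⟩
  · rw [mem_ball_zero_iff, Complex.norm_real, Real.norm_of_nonneg ht.1.le]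
    exact ht.2
  · exact ht.1

theorem normSq_lt_one {z : ℂ} (hz : z ∈ halfDisc) : z.re * z.re + z.im * z.im < 1 := by
  have h := mem_ball_zero_iff.mp hz.1
  rw [← Complex.normSq_apply, Complex.normSq_eq_norm_sq]
  nlinarith [norm_nonneg z]

/-- The right half of the disc is mapped into the disc, as `|1 - z| < |1 + z|` there. -/
theorem rotInv_mem_ball {z : ℂ} (hz : z ∈ halfDisc) : rotInv z ∈ Metric.ball (0 : ℂ) 1 := by
  have h2 : 0 < z.re := hz.2
  rw [mem_ball_zero_iff, rotInv, norm_div, norm_mul, Complex.norm_I, one_mul,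
    div_lt_one (norm_pos_iff.mpr (one_add_ne_zero hz))]
  refine lt_of_pow_lt_pow_left₀ 2 (norm_nonneg _) ?_
  rw [← Complex.normSq_eq_norm_sq, ← Complex.normSq_eq_norm_sq, Complex.normSq_apply,
    Complex.normSq_apply]
  simp only [Complex.sub_re, Complex.sub_im, Complex.add_re, Complex.add_im, Complex.one_re,
    Complex.one_im]
  nlinarith

/-- The image of the unit disc is the upper half-plane, which avoids the cut of the logarithm. -/
theorem rotInv_mem_slitPlane {z : ℂ} (hz : z ∈ halfDisc) : rotInv z ∈ Complex.slitPlane := by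
  have h1 := normSq_lt_one hz
  have h3 : 0 < Complex.normSq (1 + z) := Complex.normSq_pos.mpr (one_add_ne_zero hz)
  have e : (rotInv z).im = (1 - (z.re * z.re + z.im * z.im)) / Complex.normSq (1 + z) := by
    rw [rotInv, Complex.div_im]
    simp
    ring
  refine Or.inr ?_
  rw [e]
  exact (div_pos (by linarith) h3).ne'

theorem hasDerivAt_rotInv {z : ℂ} (hz : 1 + z ≠ 0) :
    HasDerivAt rotInv (-2 * Complex.I / (1 + z) ^ 2) z := by
  have h1 : HasDerivAt (fun z : ℂ => Complex.I * (1 - z)) (Complex.I * -1) z :=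
    ((hasDerivAt_id z).const_sub 1).const_mul _
  have h2 : HasDerivAt (fun z : ℂ => 1 + z) 1 z := (hasDerivAt_id z).const_add 1
  refine (h1.div h2 hz).congr_deriv ?_
  congr 1
  ring

/-- The transformation of `dz / (z - q)` for `q` the image of the pole `p`, in the form of a
partial fraction decomposition. -/
theorem rotInv_pullback {z p q : ℂ} (hz : 1 + z ≠ 0) (hp : z - p ≠ 0)
    (hpq : Complex.I * (1 - p) = q * (1 + p)) (hp1 : 1 + p ≠ 0) :
    -2 * Complex.I / (1 + z) ^ 2 * (rotInv z - q)⁻¹ = (z - p)⁻¹ - (z + 1)⁻¹ := by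
  have hz' : z + 1 ≠ 0 := by rwa [add_comm]
  have hI := Complex.I_ne_zero
  have e : rotInv z - q = -2 * Complex.I * (z - p) / ((1 + z) * (1 + p)) := by
    have hq : q = Complex.I * (1 - p) / (1 + p) := by rw [hpq, mul_div_cancel_right₀ _ hp1]
    rw [rotInv, hq]
    field_simp
    ring
  rw [e]
  field_simp
  ring

/-- The connection is invariant under the rotation of the poles, combined with `s`. -/
theorem rotInv_connection {z : ℂ} (hz : z ∈ halfDisc) :
    (-2 * Complex.I / (1 + z) ^ 2) • s (connection (rotInv z)) = connection z := by
  have h1 := one_add_ne_zero hz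
  have hI2 := Complex.I_mul_I
  have hI3 : Complex.I ^ 3 = -Complex.I := Complex.I_pow_three
  have hpole : ∀ k : ℕ, z - Complex.I ^ k ≠ 0 := sub_I_pow_ne_zero hz.1
  have hz0 : z - 0 ≠ 0 := by
    rw [sub_zero]
    exact Complex.slitPlane_ne_zero (mem_halfDisc_slitPlane hz)
  have hre : ∀ {u : ℂ}, u.re ≠ 0 → u ≠ 0 := fun {u} hu h => hu (by rw [h, Complex.zero_re])
  have p0 := rotInv_pullback (q := 0) h1 (hpole 0) (by simp) (by norm_num)
  have p1 := rotInv_pullback (q := 1) h1 (hpole 1) (by rw [pow_one]; linear_combination -hI2)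
    (hre (by simp))
  have pA := rotInv_pullback (q := Complex.I) h1 hz0 (by ring) (by norm_num)
  have p3 := rotInv_pullback (q := -1) h1 (hpole 3)
    (by rw [hI3]; linear_combination hI2) (hre (by simp [hI3]))
  have pC : -2 * Complex.I / (1 + z) ^ 2 * (rotInv z - -Complex.I)⁻¹ = -(z + 1)⁻¹ := by
    have hz' : z + 1 ≠ 0 := by rwa [add_comm]
    have hI := Complex.I_ne_zero
    have e : rotInv z - -Complex.I = 2 * Complex.I / (1 + z) := by
      rw [rotInv]
      field_simp
      ring
    rw [e]
    field_simp
    ring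
  have hs : s (connection (rotInv z)) = (rotInv z)⁻¹ • b 0 + (rotInv z - 1)⁻¹ • b 1 +
      (rotInv z - Complex.I)⁻¹ • A + (rotInv z - -1)⁻¹ • b 3 +
      (rotInv z - -Complex.I)⁻¹ • C := by
    have hmap : ∀ f, s f = substAlgHom isLinearSubst_sGen f := fun _ => rfl
    rw [connection, hmap, map_add, map_sum]
    simp only [map_smul]
    simp only [← hmap, s_A, s_b, Fin.sum_univ_four, sGen]
    simp [hI3]
    abel
  rw [hs]
  simp only [smul_add, smul_smul]
  rw [sub_zero] at p0 pA
  rw [p0, p1, pA, p3, pC, connection, C, Fin.sum_univ_four, Fin.sum_univ_four]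
  ext w
  simp only [coeff_add, coeff_sub, coeff_neg, coeff_smul, Fin.val_zero, Fin.val_one, Fin.val_two,
    pow_zero, pow_one, Complex.I_sq, sub_neg_eq_add]
  have h3 : ((3 : Fin 4) : ℕ) = 3 := rfl
  rw [h3]
  ring

/-- The image of the solution at the origin under the rotation, a solution near `1`. -/
def rotatedSolution (z : ℂ) : NCSeries Gen := s (zeroSolution (rotInv z))

/-- The solution that is equivalent to `(1 - z) ^ b[1]` at `1`. -/
def oneSolution (z : ℂ) : NCSeries Gen := rotatedSolution z * cpow (2 / Complex.I) (b 0)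

theorem coeff_oneSolution_nil (z : ℂ) : coeff (oneSolution z) [] = 1 :=
  coeff_mul_nil_eq_one ((coeff_s_nil _).trans (coeff_zeroSolution_nil _)) (coeff_exp_nil _)

theorem hasCoeffDerivAt_zeroSolution_of_mem_halfDisc {z : ℂ} (hz : z ∈ halfDisc) :
    HasCoeffDerivAt zeroSolution (connection z * zeroSolution z) z :=
  hasCoeffDerivAt_zeroSolution hz.1 (mem_halfDisc_slitPlane hz)

theorem hasCoeffDerivAt_oneSolution {z : ℂ} (hz : z ∈ halfDisc) :
    HasCoeffDerivAt oneSolution (connection z * oneSolution z) z := by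
  have h := ((hasCoeffDerivAt_zeroSolution (rotInv_mem_ball hz) (rotInv_mem_slitPlane hz)).comp
    (hasDerivAt_rotInv (one_add_ne_zero hz))).subst sGen
  refine (h.mul_const (cpow (2 / Complex.I) (b 0))).congr_deriv ?_
  rw [oneSolution, ← mul_assoc, ← rotInv_connection hz, smul_mul_assoc]
  congr 1
  rw [rotatedSolution, ← s_mul, ← substLinear_apply, map_smul]
  rfl

/-! ### Asymptotics of the two solutions -/

theorem zeroSolution_mul_cpow (z : ℂ) : zeroSolution z * cpow z (-A) = regularSolution z := by
  rw [zeroSolution, cpow, cpow, smul_neg, mul_assoc,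
    exp_mul_exp_neg (coeff_smul_nil A_coeff_nil _), mul_one]

theorem asympAtZero_zeroSolution : AsympAtZero fun t : ℝ => zeroSolution t := by
  intro w
  simp only [zeroSolution_mul_cpow]
  have h : Tendsto (fun t : ℝ => (t : ℂ)) (𝓝[>] 0) (𝓝 0) := by
    have := (Complex.continuous_ofReal.tendsto 0).mono_left
      (nhdsWithin_le_nhds (s := Set.Ioi (0 : ℝ)))
    rwa [Complex.ofReal_zero] at this
  exact (tendstoCoeff_regularSolution w).comp h

theorem rotInv_ofReal (t : ℝ) : rotInv t = (((1 - t) / (1 + t) : ℝ) : ℂ) * Complex.I := by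
  rw [rotInv]
  push_cast
  ring

/-- On the real axis the branches of the logarithms in `oneSolution` combine without any
multiple of `2 π i`. -/
theorem oneSolution_mul_cpow {t : ℝ} (ht : t ∈ Set.Ioo (0 : ℝ) 1) :
    oneSolution t * cpow (1 - (t : ℂ)) (-b 0) =
      s (regularSolution (rotInv t)) *
        exp (((Real.log 2 - Real.log (1 + t) : ℝ) : ℂ) • b 0) := by
  have h1 : (0 : ℝ) < 1 - t := sub_pos.mpr ht.2
  have h2 : (0 : ℝ) < 1 + t := by linarith [ht.1]
  have e1 : Complex.log (rotInv t) =
      ((Real.log (1 - t) - Real.log (1 + t) : ℝ) : ℂ) + Real.pi / 2 * Complex.I := by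
    rw [rotInv_ofReal, Complex.log_ofReal_mul (div_pos h1 h2) Complex.I_ne_zero, Complex.log_I,
      Real.log_div h1.ne' h2.ne']
  have e2 : Complex.log (2 / Complex.I) =
      ((Real.log 2 : ℝ) : ℂ) + -(Real.pi / 2) * Complex.I := by
    have : (2 : ℂ) / Complex.I = ((2 : ℝ) : ℂ) * -Complex.I := by
      rw [Complex.div_I]
      push_cast
      ring
    rw [this, Complex.log_ofReal_mul two_pos (neg_ne_zero.mpr Complex.I_ne_zero),
      Complex.log_neg_I]
  have e3 : Complex.log (1 - (t : ℂ)) = ((Real.log (1 - t) : ℝ) : ℂ) := by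
    rw [Complex.ofReal_log h1.le]
    push_cast
    rfl
  have e : ((Real.log 2 - Real.log (1 + t) : ℝ) : ℂ) =
      Complex.log (rotInv t) + (Complex.log (2 / Complex.I) + -Complex.log (1 - (t : ℂ))) := by
    rw [e1, e2, e3]
    push_cast
    ring
  rw [oneSolution, rotatedSolution, zeroSolution, s_mul, s_cpow _ A_coeff_nil, s_A, e,
    exp_add_smul (b_coeff_nil 0), exp_add_smul (b_coeff_nil 0), cpow, cpow, cpow, smul_neg,
    neg_smul]
  simp only [mul_assoc]

theorem asympAtOne_oneSolution : AsympAtOne fun t : ℝ => oneSolution t := by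
  have hr : Tendsto (fun t : ℝ => rotInv (t : ℂ)) (𝓝[<] 1) (𝓝 0) := by
    have h : ContinuousAt (fun t : ℝ => rotInv (t : ℂ)) 1 :=
      (hasDerivAt_rotInv (z := ((1 : ℝ) : ℂ)) (by norm_num)).comp_ofReal.continuousAt
    have h' := h.tendsto.mono_left (nhdsWithin_le_nhds (s := Set.Iio (1 : ℝ)))
    have e : rotInv ((1 : ℝ) : ℂ) = 0 := by simp [rotInv]
    rwa [e] at h'
  have hlog : Tendsto (fun t : ℝ => ((Real.log 2 - Real.log (1 + t) : ℝ) : ℂ)) (𝓝[<] 1)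
      (𝓝 0) := by
    have h : ContinuousAt (fun t : ℝ => ((Real.log 2 - Real.log (1 + t) : ℝ) : ℂ)) 1 := by
      refine Complex.continuous_ofReal.continuousAt.comp (continuousAt_const.sub ?_)
      exact ContinuousAt.log (by fun_prop) (by norm_num)
    have h' := h.tendsto.mono_left (nhdsWithin_le_nhds (s := Set.Iio (1 : ℝ)))
    have e : ((Real.log 2 - Real.log (1 + 1) : ℝ) : ℂ) = 0 := by norm_num
    rwa [e] at h'
  have h1 : TendstoCoeff (fun t : ℝ => s (regularSolution (rotInv t))) (𝓝[<] 1) 1 := by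
    have h : TendstoCoeff (fun t : ℝ => regularSolution (rotInv t)) (𝓝[<] 1) 1 :=
      fun w => (tendstoCoeff_regularSolution w).comp hr
    have h' := h.subst sGen
    rwa [subst_one] at h'
  have h2 : TendstoCoeff
      (fun t : ℝ => exp (((Real.log 2 - Real.log (1 + t) : ℝ) : ℂ) • b 0)) (𝓝[<] 1) 1 := by
    have h := (hasCoeffDerivAt_exp (b_coeff_nil 0) 0).tendstoCoeff
    rw [zero_smul, exp_zero] at h
    exact fun w => (h w).comp hlog
  have h3 := h1.mul h2
  rw [one_mul] at h3
  refine h3.congr' ?_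
  filter_upwards [Ioo_mem_nhdsLT (zero_lt_one' ℝ)] with t ht
  exact (oneSolution_mul_cpow ht).symm

theorem isSolution_of_hasCoeffDerivAt {H : ℂ → NCSeries Gen} (h1 : ∀ z, coeff (H z) [] = 1)
    (h : ∀ z ∈ halfDisc, HasCoeffDerivAt H (connection z * H z) z) :
    IsSolution fun t : ℝ => H t := fun t ht =>
  ⟨isUnit_of_coeff_nil (h1 t), (h t (ofReal_mem_halfDisc ht)).comp_ofReal⟩

/-- A solution on `]0, 1[` is determined by its asymptotics. -/
theorem eq_of_asymptotics {H H' : ℝ → NCSeries Gen} (h1 : ∀ t, coeff (H t) [] = 1)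
    (hH : IsSolution H) (hH' : IsSolution H') {l : Filter ℝ} [l.NeBot]
    (hl : ∀ᶠ t in l, t ∈ Set.Ioo (0 : ℝ) 1) {g : ℝ → NCSeries Gen}
    (hg : ∀ t, coeff (g t) [] = 1) (ha : TendstoCoeff (fun t => H t * g t) l 1)
    (ha' : TendstoCoeff (fun t => H' t * g t) l 1) {t : ℝ} (ht : t ∈ Set.Ioo (0 : ℝ) 1) :
    H' t = H t := by
  have hconst : ∀ u ∈ Set.Ioo (0 : ℝ) 1,
      Ring.inverse (H u) * H' u = Ring.inverse (H t) * H' t := fun u hu =>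
    inverse_mul_eq_of_flow isOpen_Ioo isPreconnected_Ioo (ω := fun t : ℝ => connection t) h1
      (fun u hu => (hH u hu).2) (fun u hu => (hH' u hu).2) hu ht
  have hc : Ring.inverse (H t) * H' t = 1 := by
    refine eq_one_of_tendsto_conj (l := l) hg ?_
    have h := (TendstoCoeff.inverse
      (Eventually.of_forall fun u => coeff_mul_nil_eq_one (h1 u) (hg u)) coeff_one_nil ha).mul ha'
    rw [Ring.inverse_one, one_mul] at h
    refine h.congr' (hl.mono fun u hu => ?_)
    rw [← hconst u hu, inverse_mul_rev (h1 u) (hg u)]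
    simp only [mul_assoc]
  rw [← one_mul (H' t), ← mul_inverse (h1 t), mul_assoc, hc, mul_one]

/-! ### The renormalized holonomy -/

theorem connection_mem_freeLieCompletion (z : ℂ) : connection z ∈ freeLieCompletion Gen :=
  add_mem_freeLieCompletion (smul_mem_freeLieCompletion _ (X_mem_freeLieCompletion _))
    (sum_mem_freeLieCompletion _ fun _ _ =>
      smul_mem_freeLieCompletion _ (X_mem_freeLieCompletion _))

theorem euler_X {α : Type} (a : α) : euler (X a : NCSeries α) = X a := by
  classical
  ext w
  rw [coeff_euler, coeff_X]
  split_ifs with h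
  · simp [h]
  · rw [mul_zero]

/-- The holonomy `H₁⁻¹ H₀`, evaluated at `1 / 2`. -/
def psi4 : NCSeries Gen :=
  Ring.inverse (oneSolution ((1 / 2 : ℝ) : ℂ)) * zeroSolution ((1 / 2 : ℝ) : ℂ)

theorem half_mem_Ioo : (1 / 2 : ℝ) ∈ Set.Ioo (0 : ℝ) 1 := by constructor <;> norm_num

theorem psi4_eq {z : ℂ} (hz : z ∈ halfDisc) :
    psi4 = Ring.inverse (oneSolution z) * zeroSolution z :=
  inverse_mul_eq_of_flow isOpen_halfDisc isPreconnected_halfDisc (ω := connection)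
    coeff_oneSolution_nil (fun _ hu => hasCoeffDerivAt_oneSolution hu)
    (fun _ hu => hasCoeffDerivAt_zeroSolution_of_mem_halfDisc hu)
    (ofReal_mem_halfDisc half_mem_Ioo) hz

theorem isSolution_zeroSolution : IsSolution fun t : ℝ => zeroSolution t :=
  isSolution_of_hasCoeffDerivAt coeff_zeroSolution_nil
    fun _ => hasCoeffDerivAt_zeroSolution_of_mem_halfDisc

theorem isSolution_oneSolution : IsSolution fun t : ℝ => oneSolution t :=
  isSolution_of_hasCoeffDerivAt coeff_oneSolution_nil fun _ => hasCoeffDerivAt_oneSolution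

theorem isPsi4_psi4 : IsPsi4 psi4 :=
  ⟨_, _, isSolution_zeroSolution, asympAtZero_zeroSolution, isSolution_oneSolution,
    asympAtOne_oneSolution, fun _ ht => psi4_eq (ofReal_mem_halfDisc ht)⟩

theorem eventually_mem_Ioo_nhdsGT_zero : ∀ᶠ t in 𝓝[>] (0 : ℝ), t ∈ Set.Ioo (0 : ℝ) 1 :=
  Ioo_mem_nhdsGT one_pos

theorem eventually_mem_Ioo_nhdsLT_one : ∀ᶠ t in 𝓝[<] (1 : ℝ), t ∈ Set.Ioo (0 : ℝ) 1 :=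
  Ioo_mem_nhdsLT one_pos

theorem IsPsi4.eq_psi4 {Ψ : NCSeries Gen} (h : IsPsi4 Ψ) : Ψ = psi4 := by
  obtain ⟨H₀, H₁, hH₀, ha₀, hH₁, ha₁, hΨ⟩ := h
  have e₀ : H₀ (1 / 2) = zeroSolution ((1 / 2 : ℝ) : ℂ) :=
    eq_of_asymptotics (fun _ => coeff_zeroSolution_nil _) isSolution_zeroSolution hH₀
      eventually_mem_Ioo_nhdsGT_zero (g := fun t : ℝ => cpow t (-A)) (fun _ => coeff_exp_nil _)
      asympAtZero_zeroSolution ha₀ half_mem_Ioo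
  have e₁ : H₁ (1 / 2) = oneSolution ((1 / 2 : ℝ) : ℂ) :=
    eq_of_asymptotics (fun _ => coeff_oneSolution_nil _) isSolution_oneSolution hH₁
      eventually_mem_Ioo_nhdsLT_one (g := fun t : ℝ => cpow (1 - (t : ℂ)) (-b 0))
      (fun _ => coeff_exp_nil _) asympAtOne_oneSolution ha₁ half_mem_Ioo
  rw [hΨ _ half_mem_Ioo, e₀, e₁, psi4]

theorem psi4_mem_expFreeLie : psi4 ∈ expFreeLie Gen := by
  have hX : ∀ a : Gen, -X a ∈ freeLieCompletion Gen ∧ euler (-X a : NCSeries Gen) = -X a :=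
    fun a => ⟨neg_mem_freeLieCompletion (X_mem_freeLieCompletion a), by rw [map_neg, euler_X]⟩
  have h₀ : zeroSolution ((1 / 2 : ℝ) : ℂ) ∈ expFreeLie Gen :=
    mem_expFreeLie_of_flow_of_tendsto isOpen_Ioo isPreconnected_Ioo
      (H := fun t : ℝ => zeroSolution t) (ω := fun t : ℝ => connection t)
      (fun _ _ => connection_mem_freeLieCompletion _) (fun _ => coeff_zeroSolution_nil _)
      (fun t ht => (isSolution_zeroSolution t ht).2) eventually_mem_Ioo_nhdsGT_zero
      (φ := fun t : ℝ => Complex.log t) (φ' := fun t : ℝ => (t : ℂ)⁻¹)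
      (fun t ht => (Complex.hasDerivAt_log
        (mem_halfDisc_slitPlane (ofReal_mem_halfDisc ht))).comp_ofReal)
      (hX none).1 (hX none).2 asympAtZero_zeroSolution half_mem_Ioo
  have h₁ : oneSolution ((1 / 2 : ℝ) : ℂ) ∈ expFreeLie Gen := by
    refine mem_expFreeLie_of_flow_of_tendsto isOpen_Ioo isPreconnected_Ioo
      (H := fun t : ℝ => oneSolution t) (ω := fun t : ℝ => connection t)
      (fun _ _ => connection_mem_freeLieCompletion _) (fun _ => coeff_oneSolution_nil _)
      (fun t ht => (isSolution_oneSolution t ht).2) eventually_mem_Ioo_nhdsLT_one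
      (φ := fun t : ℝ => Complex.log (1 - (t : ℂ))) (φ' := fun t : ℝ => -1 / (1 - (t : ℂ)))
      (fun t ht => ?_)
      (hX (some 0)).1 (hX (some 0)).2 asympAtOne_oneSolution half_mem_Ioo
    have h : HasDerivAt (fun z : ℂ => Complex.log (1 - z)) (-1 / (1 - (t : ℂ))) t :=
      ((hasDerivAt_id (t : ℂ)).const_sub 1).clog (Or.inl (by simpa using ht.2))
    exact h.comp_ofReal
  exact mul_mem_expFreeLie (inverse_mem_expFreeLie h₁) h₀

/-! ### The hexagon relation -/

/-- The fixed point of the rotation in the disc. -/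
def center : ℂ := ((Real.sqrt 3 - 1) / 2 : ℝ) * (1 + Complex.I)

theorem center_mem_halfDisc : center ∈ halfDisc := by
  have h3 : Real.sqrt 3 ^ 2 = 3 := Real.sq_sqrt (by norm_num)
  have h0 : 1 < Real.sqrt 3 := by
    rw [Real.lt_sqrt zero_le_one]
    norm_num
  have h2 : Real.sqrt 3 < 2 := by
    rw [Real.sqrt_lt' two_pos]
    norm_num
  have hre : center.re = (Real.sqrt 3 - 1) / 2 := by simp [center]
  have him : center.im = (Real.sqrt 3 - 1) / 2 := by simp [center]
  refine ⟨?_, ?_⟩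
  · rw [mem_ball_zero_iff]
    refine lt_of_pow_lt_pow_left₀ 2 zero_le_one ?_
    rw [← Complex.normSq_eq_norm_sq, Complex.normSq_apply, hre, him]
    nlinarith
  · show 0 < center.re
    rw [hre]
    linarith

theorem rotInv_center : rotInv center = center := by
  have h3 : (Real.sqrt 3 : ℂ) ^ 2 = 3 := by
    exact_mod_cast Real.sq_sqrt (show (0 : ℝ) ≤ 3 by norm_num)
  rw [rotInv, div_eq_iff (one_add_ne_zero center_mem_halfDisc), center]
  push_cast
  linear_combination (-Complex.I / 2) * h3 +
    (-(Real.sqrt 3 - 1) / 2 - ((Real.sqrt 3 : ℂ) - 1) ^ 2 / 4) * Complex.I_sq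

theorem hexagon_psi4 :
    cpow (2 / Complex.I) A * s (s psi4) * cpow (2 / Complex.I) (b 1) * s psi4 *
      cpow (2 / Complex.I) (b 0) * psi4 = 1 := by
  set h := zeroSolution center with hh
  have e1 : h = s h * cpow (2 / Complex.I) (b 0) * psi4 := by
    rw [psi4_eq center_mem_halfDisc]
    have e : oneSolution center = s h * cpow (2 / Complex.I) (b 0) := by
      rw [oneSolution, rotatedSolution, rotInv_center]
    rw [← e, ← mul_assoc, mul_inverse (coeff_oneSolution_nil _), one_mul]
  have e2 : s h = s (s h) * cpow (2 / Complex.I) (b 1) * s psi4 := by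
    conv_lhs => rw [e1, s_mul, s_mul, s_cpow _ (b_coeff_nil 0), s_b]
    rfl
  have e3 : s (s h) = h * cpow (2 / Complex.I) A * s (s psi4) := by
    conv_lhs => rw [e2, s_mul, s_mul, s_cpow _ (b_coeff_nil 1), s_b, s_s_s]
    rfl
  have e4 : h * (cpow (2 / Complex.I) A * s (s psi4) * cpow (2 / Complex.I) (b 1) * s psi4 *
      cpow (2 / Complex.I) (b 0) * psi4) = h := by
    conv_rhs => rw [e1, e2, e3]
    simp only [mul_assoc]
  have h1 : coeff h [] = 1 := coeff_zeroSolution_nil _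
  have e5 := congrArg (fun x => Ring.inverse h * x) e4
  simpa only [← mul_assoc, inverse_mul h1, one_mul] using e5

end KZ4

end

theorem mainTheorem1 :
    (∃! Ψ : NCSeries KZ4.Gen, KZ4.IsPsi4 Ψ) ∧
    ∀ Ψ : NCSeries KZ4.Gen, KZ4.IsPsi4 Ψ →
      Ψ ∈ NCSeries.expFreeLie KZ4.Gen ∧
      NCSeries.cpow (2 / Complex.I) KZ4.A * KZ4.s (KZ4.s Ψ) *
        NCSeries.cpow (2 / Complex.I) (KZ4.b 1) * KZ4.s Ψ *
        NCSeries.cpow (2 / Complex.I) (KZ4.b 0) * Ψ = 1 := by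
  refine ⟨⟨KZ4.psi4, KZ4.isPsi4_psi4, fun Ψ hΨ => hΨ.eq_psi4⟩, fun Ψ hΨ => ?_⟩
  rw [hΨ.eq_psi4]
  exact ⟨KZ4.psi4_mem_expFreeLie, KZ4.hexagon_psi4⟩
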